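/- **Definitions.** Let $\mathbb K\in\{\mathbb R,\mathbb C\}$; all spaces are over $\mathbb K$. For a sequence $x=(x_i)_{i\in\mathbb N}$ in a Banach space $X$ and $p\ge 1$ put $w_p(x)=\sup_{x^*\in X^*,\,\|x^*\|\le 1}\bigl(\sum_{i}|x^*(x_i)|^p\bigr)^{1/p}\in[0,\infty]$. Let $I$ be a finite index set, $X_j$ $(j\in I)$ and $Y$ Banach spaces, $r\ge1$ and $\mathbf p=(p_j)_{j\in I}\in[1,\infty)^I$. A multilinear map $T:\prod_{j\in I}X_j\to Y$ is *multiple $(r,\mathbf p)$-summing* if there is a constant $K>0$ such that for all sequences $x(j)=(x_i(j))_{i\in\mathbb N}$ in $X_j$, $j\in I$, $$\Bigl(\sum_{\mathbf i\in\mathbb N^I}\bigl\|T\bigl((x_{i_j}(j))_{j\in I}\bigr)\bigr\|^r\Bigr)^{1/r}\le K\prod_{j\in I}w_{p_j}(x(j)).$$ For $C\subset I$ and $p\ge1$, $T$ is *$(r,p)$-summing in the coordinates of $C$* if for every $z\in\prod_{j\notin C}X_j$ the multilinear map $y\mapsto T(y,z)$ on $\prod_{j\in C}X_j$ is multiple $(r,(p,\dots,p))$-summing.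 A Banach space $Y$ has *cotype* $q\in[2,\infty)$ if there is a constant $K$ such that $\bigl(\sum_{i=1}^N\|y_i\|^q\bigr)^{1/q}\le K\bigl(\mathbb E\|\sum_{i=1}^N\varepsilon_iy_i\|^q\bigr)^{1/q}$ for all $N$ and $y_1,\dots,y_N\in Y$, where the $\varepsilon_i$ are independent uniform random signs. The conjugate exponent of $p\in[1,\infty)$ is $p^*\in(1,\infty]$, with $\frac1{p^*}=1-\frac1p$. **Theorem.** Let $m\ge 2$ and let $\{1,\dots,m\}$ be the disjoint union of $n\ge2$ non-empty subsets $C_1,\dots,C_n$. Let $X_1,\dots,X_m$ be Banach spaces, let $Y$ be a Banach space with cotype $q$, and let $r_1,\dots,r_n\in[1,q)$, $p_1,\dots,p_n\in[1,+\infty)$. For $k\in\{1,\dots,n\}$ and $J\subset\{1,\dots,n\}\setminus\{k\}$ define $\gamma_{k,J}$ by $$\frac1{\gamma_{k,J}}=\frac1{r_k}-\sum_{j\notin J\cup\{k\}}\frac{|C_j|}{p_j^*}\times\frac{1-\frac q{r_k}-\frac{q|C_k|}{p_k^*}}{1-\frac q{r_j}-\frac{q|C_j|}{p_j^*}},$$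 and let $\mathbf q=(q_1,\dots,q_m)$ with $q_j=p_k$ for $j\in C_k$. Assume that there exists $J\subset\{1,\dots,n\}$ such that 1. there exists $k_0\notin J$ with $\gamma_{k_0,J}\ge q$ (in particular $\gamma_{k_0,J}$ is finite); 2. for any $k,l\in\{1,\dots,n\}\setminus J$ with $k\ne l$, $\gamma_{k,J\cup\{l\}}\in(0,q]$; 3. for any $k,l\in\{1,\dots,n\}\setminus J$ with $k\ne l$, $\dfrac{|C_l|\,\gamma_{k,J\cup\{l\}}}{p_l^*}\le1$. Set $$\frac1s=\frac1{\gamma_{k_0,J}}-\sum_{j\in J}\frac{|C_j|}{p_j^*}$$ and assume that $0<s<\infty$. Then every $m$-linear map $T:X_1\times\cdots\times X_m\to Y$ which is $(r_k,p_k)$-summing in the coordinates of $C_k$ for each $k=1,\dots,n$ is multiple $(s,\mathbf q)$-summing. -/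

import Mathlib

open scoped NNReal ENNReal

noncomputable section

/-- The weak `ℓ^p` norm `w_p(x) = sup_{‖φ‖ ≤ 1} (∑ᵢ |φ(xᵢ)|^p)^{1/p} ∈ [0, ∞]` of a sequence `x`
in a normed space, the supremum being over the functionals in the dual unit ball. -/
def weakNorm (𝕜 : Type*) [RCLike 𝕜] {E : Type*} [NormedAddCommGroup E] [NormedSpace 𝕜 E]
    (p : ℝ) (x : ℕ → E) : ℝ≥0∞ :=
  ⨆ (φ : StrongDual 𝕜 E) (_ : ‖φ‖ ≤ 1), (∑' i, ‖φ (x i)‖ₑ ^ p) ^ (1 / p)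

/-- A multilinear map `T` is multiple `(r, 𝐩)`-summing if there is a constant `K > 0` with
`(∑_{𝐢 ∈ ℕ^ι} ‖T(x_{i_j}(j))_j‖^r)^{1/r} ≤ K ∏_j w_{p_j}(x(j))`
for all sequences `x(j)` in `X_j`, `j ∈ ι`. All quantities are taken in `[0, ∞]`. -/
def IsMultipleSumming {𝕜 : Type*} [RCLike 𝕜] {ι : Type*} [Fintype ι] {X : ι → Type*}
    [∀ j, NormedAddCommGroup (X j)] [∀ j, NormedSpace 𝕜 (X j)]
    {Y : Type*} [NormedAddCommGroup Y] [NormedSpace 𝕜 Y]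
    (T : MultilinearMap 𝕜 X Y) (r : ℝ) (p : ι → ℝ) : Prop :=
  ∃ K : ℝ≥0, 0 < K ∧ ∀ x : ∀ j, ℕ → X j,
    (∑' i : ι → ℕ, ‖T (fun j => x j (i j))‖ₑ ^ r) ^ (1 / r)
      ≤ (K : ℝ≥0∞) * ∏ j, weakNorm 𝕜 (p j) (x j)

/-- `T` is (coordinatewise multiple) `(r, p)`-summing in the coordinates of `C`: for every choice
`z` of the coordinates outside `C`, the multilinear map `T^C(z) : y ↦ T(y, z)` on `∏_{j ∈ C} X_j`
is multiple `(r, p)`-summing, with the same `p` for all the coordinates in `C`. -/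
def IsSummingInCoords {𝕜 : Type*} [RCLike 𝕜] {ι : Type*} [DecidableEq ι]
    {X : ι → Type*} [∀ j, NormedAddCommGroup (X j)] [∀ j, NormedSpace 𝕜 (X j)]
    {Y : Type*} [NormedAddCommGroup Y] [NormedSpace 𝕜 Y]
    (T : MultilinearMap 𝕜 X Y) (C : Finset ι) (r p : ℝ) : Prop :=
  ∀ z : ∀ j : {j // j ∉ C}, X j,
    IsMultipleSumming (T.domDomRestrict (fun j => j ∈ C) z) r (fun _ => p)

/-- `Y` has cotype `q` (`2 ≤ q < ∞`): for some constant `K` and all finite families `x` in `Y`,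
`(∑ᵢ ‖xᵢ‖^q)^{1/q} ≤ K (𝔼 ‖∑ᵢ εᵢ xᵢ‖^q)^{1/q}`, where the `εᵢ` are independent uniform signs
(the expectation is the average over all choices of signs). -/
def HasCotype (Y : Type*) [NormedAddCommGroup Y] (q : ℝ) : Prop :=
  2 ≤ q ∧ ∃ K : ℝ, ∀ (N : ℕ) (x : Fin N → Y),
    (∑ i, ‖x i‖ ^ q) ^ (1 / q)
      ≤ K * (((2 : ℝ) ^ N)⁻¹ * ∑ ε : Fin N → ℤˣ, ‖∑ i, (ε i : ℤ) • x i‖ ^ q) ^ (1 / q)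

/-- `1 / p^*`, where `p^* ∈ (1, ∞]` is the conjugate exponent of `p ∈ [1, ∞)`;
it is `0` for `p = 1`. -/
def invConj (p : ℝ) : ℝ := 1 - 1 / p

/-- `1 / γ_{k,J} = 1/r_k - ∑_{j ∉ J ∪ {k}} (c_j / p_j^*) ·
(1 - q/r_k - q c_k/p_k^*) / (1 - q/r_j - q c_j/p_j^*)`, where `c_j` is the size of the
`j`-th block. -/
def invGamma {n : ℕ} (q : ℝ) (c : Fin n → ℕ) (r p : Fin n → ℝ) (k : Fin n)
    (J : Finset (Fin n)) : ℝ :=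
  1 / r k - ∑ j ∈ Finset.univ \ (J ∪ {k}),
    (c j * invConj (p j)) *
      ((1 - q / r k - q * c k * invConj (p k)) / (1 - q / r j - q * c j * invConj (p j)))

/-- The exponent `γ_{k,J}`. It is only meaningful if `1 / γ_{k,J} ≠ 0`;
otherwise it has the value `0`. -/
def gammaExp {n : ℕ} (q : ℝ) (c : Fin n → ℕ) (r p : Fin n → ℝ) (k : Fin n)
    (J : Finset (Fin n)) : ℝ :=
  1 / invGamma q c r p k J

end

/-! Two mechanisms drive the proof. First, by Hölder, multiplying a family of weak `ℓ^p` norm at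
most one by `g ^ (1 / p^*)`, with `g` in the unit ball of `ℓ^1`, makes its weak `ℓ^1` norm at most
one. A bound in terms of weak `ℓ^1` norms is therefore a weighted bound for weak `ℓ^p` norms, valid
for every weight `g`; removing the weights costs summability and produces the terms `|C_j| / p_j^*`.
Second, signed sums of a family of weak `ℓ^1` norm at most one lie in the unit ball, so cotype `q`
allows such a coordinate to be summed in `ℓ^q`.

One block (`exists_mixedBound_singleton`). By uniform boundedness, the summing constants of `T` in
the coordinates of `C_k` are uniform when the other coordinates stay in the unit balls. Cotype is
applied to those coordinates one at a time. The Khintchine-Kahane inequality turns the Rademacher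
average into a first moment, which Minkowski's inequality pulls out of `ℓ^{r_k}(ℓ^q)`. The outcome
is an `ℓ^{r_k}(ℓ^q)` bound with weak `ℓ^{p_k}` norms in `C_k` and weak `ℓ^1` norms elsewhere.

More blocks (`MixedBound.interpolate`). Let `L` be the set of blocks measured by their own `p`.
Bounds for `k` with `L \ {l}` and for `l` with `L \ {k}` interpolate to a bound for `k` with `L`;
the real-variable core is `sum_rpow_sum_le_one_of_weighted`. By `invGamma_compl_eq` the resulting
exponents are exactly the `γ_{k,Lᶜ}`. Induction on `|L|` reaches `L = Jᶜ`, condition 2 keeping the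
exponents of the smaller sets at most `q`.

Conclusion (`MixedBound.exists_sum_le`). As `γ_{k₀,J} ≥ q`, the `ℓ^γ(ℓ^q)` sum dominates the plain
`ℓ^γ` sum, and the weights in all blocks of `J` are removed together, which gives `s`. -/

/-! ### Hölder and Minkowski inequalities for weighted and mixed sums -/

theorem Finset.sum_rpow_mul_rpow_le {β : Type*} (s : Finset β) (f g : β → ℝ)
    (hf : ∀ b, 0 ≤ f b) (hg : ∀ b, 0 ≤ g b) {θ : ℝ} (h0 : 0 ≤ θ) (h1 : θ ≤ 1) :
    ∑ b ∈ s, f b ^ θ * g b ^ (1 - θ) ≤ (∑ b ∈ s, f b) ^ θ * (∑ b ∈ s, g b) ^ (1 - θ) := by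
  rcases h0.eq_or_lt with rfl | h0
  · simp
  rcases h1.eq_or_lt with rfl | h1
  · simp
  have hF : 0 ≤ ∑ b ∈ s, f b := Finset.sum_nonneg fun b _ => hf b
  have hG : 0 ≤ ∑ b ∈ s, g b := Finset.sum_nonneg fun b _ => hg b
  have h1' : 0 < 1 - θ := by linarith
  rcases hF.eq_or_lt with hF0 | hF0
  · rw [← hF0, Real.zero_rpow h0.ne', zero_mul]
    have := (Finset.sum_eq_zero_iff_of_nonneg fun b _ => hf b).1 hF0.symm
    refine (Finset.sum_eq_zero fun b hb => ?_).le
    rw [this b hb, Real.zero_rpow h0.ne', zero_mul]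
  rcases hG.eq_or_lt with hG0 | hG0
  · rw [← hG0, Real.zero_rpow h1'.ne', mul_zero]
    have := (Finset.sum_eq_zero_iff_of_nonneg fun b _ => hg b).1 hG0.symm
    refine (Finset.sum_eq_zero fun b hb => ?_).le
    rw [this b hb, Real.zero_rpow h1'.ne', mul_zero]
  set F := ∑ b ∈ s, f b with hFd
  set G := ∑ b ∈ s, g b with hGd
  have key : ∀ b, f b ^ θ * g b ^ (1 - θ)
      ≤ (F ^ θ * G ^ (1 - θ)) * (θ * (f b / F) + (1 - θ) * (g b / G)) := by
    intro b
    have := Real.geom_mean_le_arith_mean2_weighted h0.le h1'.le (div_nonneg (hf b) hF)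
      (div_nonneg (hg b) hG) (by ring)
    rw [Real.div_rpow (hf b) hF, Real.div_rpow (hg b) hG, div_mul_div_comm,
      div_le_iff₀ (by positivity)] at this
    linarith
  calc _ ≤ ∑ b ∈ s, (F ^ θ * G ^ (1 - θ)) * (θ * (f b / F) + (1 - θ) * (g b / G)) :=
        Finset.sum_le_sum fun b _ => key b
    _ = F ^ θ * G ^ (1 - θ) := by
        rw [← Finset.mul_sum, Finset.sum_add_distrib, ← Finset.mul_sum, ← Finset.mul_sum,
          ← Finset.sum_div, ← Finset.sum_div, ← hFd, ← hGd, div_self hF0.ne', div_self hG0.ne']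
        ring

/-- A nonnegative function on a finite power is dominated by its marginals. -/
theorem exists_marginals {κ α : Type*} [Fintype κ] [DecidableEq κ] [Fintype α]
    (h : (κ → α) → ℝ) (h0 : ∀ v, 0 ≤ h v) (h1 : ∑ v, h v ≤ 1) :
    ∃ g : κ → α → ℝ, (∀ j t, 0 ≤ g j t) ∧ (∀ j, ∑ t, g j t ≤ 1) ∧ ∀ v j, h v ≤ g j (v j) := by
  classical
  refine ⟨fun j t => ∑ v with v j = t, h v, fun j t => Finset.sum_nonneg fun v _ => h0 v,
    fun j => ?_, fun v j => ?_⟩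
  · refine le_of_eq_of_le ?_ h1
    exact Finset.sum_fiberwise Finset.univ (fun v => v j) h
  · exact Finset.single_le_sum (f := h) (fun v _ => h0 v) (by simp)

/-- The two-block interpolation inequality for weighted mixed `ℓ^γ(ℓ^q)` sums. -/
theorem sum_rpow_sum_le_one_of_weighted {U V : Type*} [Fintype U] [Fintype V]
    (c : U → V → ℝ) (hc : ∀ u v, 0 ≤ c u v) {q r r' tk tl γ : ℝ} (hq : 0 < q) (hr : 0 < r)
    (hr' : 0 < r') (hrq' : r' ≤ q) (htk : 0 ≤ tk) (htl : 0 ≤ tl) (hγ0 : 0 < γ)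
    (hγ : 1 / γ = 1 / r - tl * ((q / r - 1 + q * tk) / (q / r' - 1 + q * tl)))
    (H1 : ∀ h : V → ℝ, (∀ v, 0 ≤ h v) → ∑ v, h v ≤ 1 →
      ∑ u, (∑ v, h v ^ (tl * q) * c u v) ^ (r / q) ≤ 1)
    (H2 : ∀ g : U → ℝ, (∀ u, 0 ≤ g u) → ∑ u, g u ≤ 1 →
      ∑ v, (∑ u, g u ^ (tk * q) * c u v) ^ (r' / q) ≤ 1) :
    ∑ u, (∑ v, c u v) ^ (γ / q) ≤ 1 := by
  rcases htl.eq_or_lt with rfl | htl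
  · have : γ = r := by
      have : 1 / γ = 1 / r := by simpa using hγ
      rwa [div_eq_div_iff hγ0.ne' hr.ne', one_mul, one_mul, eq_comm] at this
    -- Here the weight is `0 ^ 0 = 1`, so the zero function already gives the unweighted sum.
    simpa [this] using H1 (fun _ => 0) (fun _ => le_rfl) (by simp)
  set Cu : U → ℝ := fun u => ∑ v, c u v with hCu
  have hCu0 : ∀ u, 0 ≤ Cu u := fun u => Finset.sum_nonneg fun v _ => hc u v
  set S : ℝ := ∑ u, Cu u ^ (γ / q) with hS
  change S ≤ 1
  have hterm0 : ∀ u, 0 ≤ Cu u ^ (γ / q) := fun u => Real.rpow_nonneg (hCu0 u) _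
  have hS0 : 0 ≤ S := Finset.sum_nonneg fun u _ => hterm0 u
  rcases hS0.eq_or_lt with h | hSpos
  · rw [← h]; exact zero_le_one
  -- The extremal weight for the sum to be bounded. Testing `H2` on it makes `D ^ (r' / q)` an
  -- admissible weight for `H1`.
  set g : U → ℝ := fun u => Cu u ^ (γ / q) / S with hg
  have hg0 : ∀ u, 0 ≤ g u := fun u => div_nonneg (hterm0 u) hS0
  have hgsum : ∑ u, g u = 1 := by rw [← Finset.sum_div, ← hS, div_self hSpos.ne']
  set D : V → ℝ := fun v => ∑ u, g u ^ (tk * q) * c u v with hD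
  have hgt0 : ∀ u, 0 ≤ g u ^ (tk * q) := fun u => Real.rpow_nonneg (hg0 u) _
  have hD0 : ∀ v, 0 ≤ D v := fun v => Finset.sum_nonneg fun u _ => mul_nonneg (hgt0 u) (hc u v)
  have hDsum : ∑ v, D v ^ (r' / q) ≤ 1 := H2 g hg0 hgsum.le
  set x : ℝ := 1 - r' / q with hx
  have hden : 0 < q / r' - 1 + q * tl := by
    have : 1 ≤ q / r' := (one_le_div hr').2 hrq'
    have : 0 < q * tl := mul_pos hq htl
    linarith
  -- Chosen so that the powers of `D` cancel in `E ^ θ * F ^ (1 - θ)`, see `hxθ`; Hölder in `v` then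
  -- bounds `Cu` by this product.
  set θ : ℝ := (q / r' - 1) / (q / r' - 1 + q * tl) with hθ
  have hθ0 : 0 ≤ θ := div_nonneg (by have := (one_le_div hr').2 hrq'; linarith) hden.le
  have h1θ : 1 - θ = q * tl / (q / r' - 1 + q * tl) := by
    rw [hθ, eq_div_iff hden.ne', sub_mul, div_mul_cancel₀ _ hden.ne']; ring
  have h1θ0 : 0 < 1 - θ := by rw [h1θ]; exact div_pos (mul_pos hq htl) hden
  have hxθ : r' * tl * θ = x * (1 - θ) := by
    rw [h1θ, hθ, hx]; field_simp
  set E : U → ℝ := fun u => ∑ v, D v ^ (r' * tl) * c u v with hE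
  have hE0 : ∀ u, 0 ≤ E u := fun u => Finset.sum_nonneg fun v _ =>
    mul_nonneg (Real.rpow_nonneg (hD0 v) _) (hc u v)
  have hEsum : ∑ u, E u ^ (r / q) ≤ 1 := by
    refine le_of_eq_of_le ?_ (H1 (fun v => D v ^ (r' / q))
      (fun v => Real.rpow_nonneg (hD0 v) _) hDsum)
    refine Finset.sum_congr rfl fun u _ => ?_
    congr 1
    refine Finset.sum_congr rfl fun v _ => ?_
    rw [← Real.rpow_mul (hD0 v)]
    congr 2
    field_simp
  set F : U → ℝ := fun u => ∑ v, D v ^ (-x) * c u v with hF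
  have hF0 : ∀ u, 0 ≤ F u := fun u => Finset.sum_nonneg fun v _ =>
    mul_nonneg (Real.rpow_nonneg (hD0 v) _) (hc u v)
  have hFsum : ∑ u, g u ^ (tk * q) * F u ≤ 1 := by
    refine le_trans (le_of_eq ?_) hDsum
    simp only [hF, Finset.mul_sum]
    rw [Finset.sum_comm]
    refine Finset.sum_congr rfl fun v _ => ?_
    rw [show r' / q = -x + 1 by rw [hx]; ring]
    rcases (hD0 v).eq_or_lt with h | h
    · have hz : ∀ u, g u ^ (tk * q) * c u v = 0 := fun u =>
        (Finset.sum_eq_zero_iff_of_nonneg fun u _ => mul_nonneg (hgt0 u) (hc u v)).1 h.symm u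
          (Finset.mem_univ u)
      have hne : -x + 1 ≠ 0 := by
        rw [hx]
        have : 0 < r' / q := by positivity
        intro h; linarith
      refine (Finset.sum_eq_zero fun u _ => ?_).trans (Eq.symm ?_)
      · rw [mul_left_comm, hz, mul_zero]
      · rw [← h, Real.zero_rpow hne]
    · rw [Real.rpow_add h, Real.rpow_one]
      simp only [hD, Finset.mul_sum]
      exact Finset.sum_congr rfl fun u _ => by ring
  have hgpos : ∀ u, 0 < Cu u → 0 < g u := fun u hu => div_pos (Real.rpow_pos_of_pos hu _) hSpos
  have hCEF : ∀ u, 0 < Cu u → Cu u ≤ E u ^ θ * F u ^ (1 - θ) := by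
    intro u hu
    refine le_trans (le_of_eq ?_) (Finset.sum_rpow_mul_rpow_le Finset.univ
      (fun v => D v ^ (r' * tl) * c u v) (fun v => D v ^ (-x) * c u v)
      (fun v => mul_nonneg (Real.rpow_nonneg (hD0 v) _) (hc u v))
      (fun v => mul_nonneg (Real.rpow_nonneg (hD0 v) _) (hc u v)) hθ0 (by linarith))
    refine Finset.sum_congr rfl fun v _ => ?_
    rcases (hc u v).eq_or_lt with h | h
    · rw [← h]; simp only [mul_zero]
      rw [Real.zero_rpow h1θ0.ne', mul_zero]
    · have hDv : 0 < D v := lt_of_lt_of_le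
        (mul_pos (Real.rpow_pos_of_pos (hgpos u hu) (tk * q)) h)
        (Finset.single_le_sum (f := fun u => g u ^ (tk * q) * c u v)
          (fun u _ => mul_nonneg (hgt0 u) (hc u v)) (Finset.mem_univ u))
      rw [Real.mul_rpow (Real.rpow_nonneg hDv.le _) h.le,
        Real.mul_rpow (Real.rpow_nonneg hDv.le _) h.le, ← Real.rpow_mul hDv.le,
        ← Real.rpow_mul hDv.le, mul_mul_mul_comm, ← Real.rpow_add hDv, ← Real.rpow_add h, hxθ]
      simp
  -- The exponent of the second Hölder inequality, now in `u`. It gives `S ^ (η / γ) ≤ 1`, by the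
  -- choice of `g` and the identity `1 / γ = 1 / η - tk * (1 - θ)`.
  set ηi : ℝ := θ / r + (1 - θ) / q with hηi
  have hηi0 : 0 < ηi := add_pos_of_nonneg_of_pos (by positivity) (by positivity)
  set η : ℝ := 1 / ηi with hη
  have hη0 : 0 < η := by positivity
  have hηη : η * ηi = 1 := by rw [hη]; field_simp
  have hγη : 1 / γ = ηi - tk * (1 - θ) := by
    have : tl * ((q / r - 1 + q * tk) / (q / r' - 1 + q * tl))
        = (1 - θ) * (1 / r - 1 / q + tk) := by
      rw [h1θ]; field_simp
    rw [hγ, this, hηi]; ring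
  set a : ℝ := θ * η / r with ha
  have ha1 : 1 - a = (1 - θ) * η / q := by
    have : a + (1 - θ) * η / q = 1 := by
      calc a + (1 - θ) * η / q = η * ηi := by rw [ha, hηi]; ring
        _ = 1 := hηη
    linarith
  have ha0 : 0 ≤ a := by positivity
  have ha2 : 0 ≤ 1 - a := by rw [ha1]; positivity
  have hHol := Finset.sum_rpow_mul_rpow_le Finset.univ (fun u => E u ^ (r / q))
    (fun u => g u ^ (tk * q) * F u) (fun u => Real.rpow_nonneg (hE0 u) _)
    (fun u => mul_nonneg (hgt0 u) (hF0 u)) ha0 (by linarith)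
  have hle1 : (∑ u, E u ^ (r / q)) ^ a * (∑ u, g u ^ (tk * q) * F u) ^ (1 - a) ≤ 1 := by
    refine mul_le_one₀ (Real.rpow_le_one ?_ hEsum ha0) (Real.rpow_nonneg ?_ _)
      (Real.rpow_le_one ?_ hFsum ha2)
    · exact Finset.sum_nonneg fun u _ => Real.rpow_nonneg (hE0 u) _
    · exact Finset.sum_nonneg fun u _ => mul_nonneg (hgt0 u) (hF0 u)
    · exact Finset.sum_nonneg fun u _ => mul_nonneg (hgt0 u) (hF0 u)
  have hpt : ∀ u, Cu u ^ (γ / q) * S ^ (-(tk * (1 - θ) * η))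
      ≤ (E u ^ (r / q)) ^ a * (g u ^ (tk * q) * F u) ^ (1 - a) := by
    intro u
    rcases (hCu0 u).eq_or_lt with h | h
    · rw [← h, Real.zero_rpow (by positivity), zero_mul]
      exact mul_nonneg (Real.rpow_nonneg (Real.rpow_nonneg (hE0 u) _) _)
        (Real.rpow_nonneg (mul_nonneg (hgt0 u) (hF0 u)) _)
    · have e1 : (E u ^ (r / q)) ^ a * (g u ^ (tk * q) * F u) ^ (1 - a)
          = (E u ^ θ * F u ^ (1 - θ)) ^ (η / q) * g u ^ (tk * (1 - θ) * η) := by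
        rw [Real.mul_rpow (hgt0 u) (hF0 u), Real.mul_rpow (Real.rpow_nonneg (hE0 u) _)
          (Real.rpow_nonneg (hF0 u) _), ← Real.rpow_mul (hE0 u), ← Real.rpow_mul (hE0 u),
          ← Real.rpow_mul (hF0 u), ← Real.rpow_mul (hg0 u)]
        rw [show r / q * a = θ * (η / q) by rw [ha]; field_simp,
          show (1 - a) = (1 - θ) * (η / q) by rw [ha1]; ring,
          show tk * q * ((1 - θ) * (η / q)) = tk * (1 - θ) * η by field_simp]
        ring
      have e2 : Cu u ^ (γ / q) * S ^ (-(tk * (1 - θ) * η))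
          = Cu u ^ (η / q) * g u ^ (tk * (1 - θ) * η) := by
        rw [show g u = Cu u ^ (γ / q) / S from rfl, Real.div_rpow (hterm0 u) hS0,
          ← Real.rpow_mul h.le, Real.rpow_neg hS0, ← div_eq_mul_inv,
          ← mul_div_assoc (Cu u ^ (η / q)),
          ← Real.rpow_add h]
        congr 2
        have h3 : γ * ηi = 1 + γ * (tk * (1 - θ)) := by
          rw [show ηi = 1 / γ + tk * (1 - θ) by rw [hγη]; ring]; field_simp
        have h4 : γ = η + γ * (tk * (1 - θ) * η) := by
          calc γ = γ * (η * ηi) := by rw [hηη, mul_one]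
            _ = η * (γ * ηi) := by ring
            _ = _ := by rw [h3]; ring
        field_simp
        linarith
      rw [e1, e2]
      exact mul_le_mul_of_nonneg_right (Real.rpow_le_rpow h.le (hCEF u h) (by positivity))
        (Real.rpow_nonneg (hg0 u) _)
  have hfin : S * S ^ (-(tk * (1 - θ) * η)) ≤ 1 := by
    calc S * S ^ (-(tk * (1 - θ) * η))
        = ∑ u, Cu u ^ (γ / q) * S ^ (-(tk * (1 - θ) * η)) := by rw [← Finset.sum_mul]
      _ ≤ _ := Finset.sum_le_sum fun u _ => hpt u
      _ ≤ _ := hHol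
      _ ≤ 1 := hle1
  rw [← Real.rpow_one_add' hS0] at hfin
  · by_contra! hlt
    have : 0 < 1 + -(tk * (1 - θ) * η) := by
      have : 1 + -(tk * (1 - θ) * η) = η * (1 / γ) := by
        rw [hγη, mul_sub η ηi, hηη]; ring
      rw [this]; positivity
    exact absurd hfin (not_le.2 (Real.one_lt_rpow hlt this))
  · have : 1 + -(tk * (1 - θ) * η) = η * (1 / γ) := by
        rw [hγη, mul_sub η ηi, hηη]; ring
    rw [this]; positivity

/-- If `h ^ τ • a` lies in the unit ball of `ℓ^γ` for all `h` in the unit ball of `ℓ^1`, then `a`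
lies in the unit ball of `ℓ^s`, where `1 / s = 1 / γ - τ`. -/
theorem sum_rpow_le_one_of_weighted {β : Type*} [Fintype β] (a : β → ℝ) (ha : ∀ i, 0 ≤ a i)
    {γ τ s : ℝ} (hγ : 0 < γ) (hs : 0 < s) (h : 1 / s = 1 / γ - τ)
    (H : ∀ h : β → ℝ, (∀ i, 0 ≤ h i) → ∑ i, h i ≤ 1 → ∑ i, (h i ^ τ * a i) ^ γ ≤ 1) :
    ∑ i, a i ^ s ≤ 1 := by
  set S := ∑ i, a i ^ s with hS
  have ht : ∀ i, 0 ≤ a i ^ s := fun i => Real.rpow_nonneg (ha i) _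
  have hS0 : 0 ≤ S := Finset.sum_nonneg fun i _ => ht i
  rcases hS0.eq_or_lt with h0 | hpos
  · rw [← h0]; exact zero_le_one
  -- The extremal weight: with it the hypothesis reads `S ^ (1 - τ * γ) ≤ 1`, and `1 - τ * γ = γ / s
  -- > 0`.
  have hH := H (fun i => a i ^ s / S) (fun i => div_nonneg (ht i) hS0)
    (by rw [← Finset.sum_div, ← hS, div_self hpos.ne'])
  have hsg : s = γ + s * τ * γ := by
    have : τ = 1 / γ - 1 / s := by linarith
    rw [this]; field_simp; ring
  have hpt : ∀ i, ((a i ^ s / S) ^ τ * a i) ^ γ = a i ^ s * S ^ (-(τ * γ)) := by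
    intro i
    rcases (ha i).eq_or_lt with h0 | h0
    · rw [← h0, mul_zero, Real.zero_rpow hγ.ne', Real.zero_rpow hs.ne', zero_mul]
    · rw [Real.mul_rpow (Real.rpow_nonneg (div_nonneg (ht i) hS0) _) h0.le,
        ← Real.rpow_mul (div_nonneg (ht i) hS0), Real.div_rpow (ht i) hS0,
        ← Real.rpow_mul h0.le, Real.rpow_neg hS0, div_mul_eq_mul_div, ← Real.rpow_add h0,
        div_eq_mul_inv]
      congr 2
      linarith
  simp only [hpt] at hH
  rw [← Finset.sum_mul, ← hS, ← Real.rpow_one_add' hS0] at hH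
  · by_contra! hlt
    have : 0 < 1 + -(τ * γ) := by
      have : 1 + -(τ * γ) = γ / s := by
        rw [show τ = 1 / γ - 1 / s by linarith]; field_simp; ring
      rw [this]; positivity
    exact absurd hH (not_le.2 (Real.one_lt_rpow hlt this))
  · have : 1 + -(τ * γ) = γ / s := by
      rw [show τ = 1 / γ - 1 / s by linarith]; field_simp; ring
    rw [this]; positivity

/-- Minkowski's inequality in `ℓ^r(ℓ^q)`, `1 ≤ r ≤ q`, with an average over a finite set. -/
theorem sum_rpow_sum_average_le {U I Ω : Type*} [Fintype U] [Fintype Ω] [Nonempty Ω]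
    (F : U → Finset I) (b : U → I → Ω → ℝ) (hb : ∀ u i ω, 0 ≤ b u i ω) {q r : ℝ} (hr : 1 ≤ r)
    (hrq : r ≤ q) :
    ∑ u, (∑ i ∈ F u, ((Fintype.card Ω : ℝ)⁻¹ * ∑ ω, b u i ω) ^ q) ^ (r / q)
      ≤ (Fintype.card Ω : ℝ)⁻¹ * ∑ ω, ∑ u, (∑ i ∈ F u, b u i ω ^ q) ^ (r / q) := by
  have hq : 0 < q := by linarith
  rw [Finset.sum_comm, Finset.mul_sum]
  refine Finset.sum_le_sum fun u _ => ?_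
  set w : ℝ := (Fintype.card Ω : ℝ)⁻¹ with hw
  have hw0 : 0 ≤ w := by positivity
  have hw1 : ∑ _ω : Ω, w = 1 := by
    rw [Finset.sum_const, Finset.card_univ, nsmul_eq_mul, hw, mul_inv_cancel₀]
    exact_mod_cast Fintype.card_ne_zero
  have hB0 : ∀ ω, 0 ≤ ∑ i ∈ F u, b u i ω ^ q := fun ω =>
    Finset.sum_nonneg fun i _ => Real.rpow_nonneg (hb u i ω) _
  have mink : (∑ i ∈ F u, (w * ∑ ω, b u i ω) ^ q) ^ (1 / q)
      ≤ ∑ ω, w * (∑ i ∈ F u, b u i ω ^ q) ^ (1 / q) := by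
    have : Fact (1 ≤ ENNReal.ofReal q) :=
      ⟨by rw [← ENNReal.ofReal_one]; exact ENNReal.ofReal_le_ofReal (by linarith)⟩
    have hqt : (ENNReal.ofReal q).toReal = q := ENNReal.toReal_ofReal hq.le
    let v : Ω → PiLp (ENNReal.ofReal q) (fun _ : F u => ℝ) := fun ω =>
      WithLp.toLp _ fun i => w * b u i ω
    have hnorm : ∀ f : F u → ℝ, (∀ i, 0 ≤ f i) →
        ‖(WithLp.toLp (ENNReal.ofReal q) f : PiLp (ENNReal.ofReal q) (fun _ : F u => ℝ))‖
          = (∑ i, f i ^ q) ^ (1 / q) := by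
      intro f hf
      rw [PiLp.norm_eq_sum (by rw [hqt]; exact hq), hqt]
      congr 1
      exact Finset.sum_congr rfl fun i _ => by
        simp [abs_of_nonneg (hf i)]
    have h := norm_sum_le Finset.univ v
    have e1 : ∑ ω, v ω = WithLp.toLp (ENNReal.ofReal q) fun i : F u => w * ∑ ω, b u i ω := by
      ext i
      simp [v, Finset.mul_sum]
    rw [e1, hnorm _ fun i => mul_nonneg hw0 (Finset.sum_nonneg fun ω _ => hb u i ω)] at h
    rw [← Finset.sum_coe_sort (F u)]
    refine h.trans (Finset.sum_le_sum fun ω _ => ?_)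
    simp only [v]
    rw [hnorm _ fun i => mul_nonneg hw0 (hb u i ω)]
    rw [← Finset.sum_coe_sort (F u) (fun i => b u i ω ^ q)]
    simp only [Real.mul_rpow hw0 (hb u _ ω)]
    rw [← Finset.mul_sum, Real.mul_rpow (y := ∑ i : F u, b u i ω ^ q) (Real.rpow_nonneg hw0 _)
      (Finset.sum_nonneg fun i _ => Real.rpow_nonneg (hb u i ω) _), ← Real.rpow_mul hw0,
      mul_one_div_cancel hq.ne', Real.rpow_one]
  have hA0 : 0 ≤ ∑ i ∈ F u, (w * ∑ ω, b u i ω) ^ q := Finset.sum_nonneg fun i _ =>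
    Real.rpow_nonneg (mul_nonneg hw0 (Finset.sum_nonneg fun ω _ => hb u i ω)) _
  have hrq' : r / q = 1 / q * r := by ring
  rw [hrq', Real.rpow_mul hA0]
  refine (Real.rpow_le_rpow (Real.rpow_nonneg hA0 _) mink (by linarith)).trans ?_
  -- Convexity of `t ↦ t ^ r`, which needs `1 ≤ r`.
  refine (Real.rpow_arith_mean_le_arith_mean_rpow Finset.univ (fun _ => w) _ (fun _ _ => hw0) hw1
    (fun ω _ => Real.rpow_nonneg (hB0 ω) _) hr).trans (le_of_eq ?_)
  rw [Finset.mul_sum]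
  exact Finset.sum_congr rfl fun ω _ => by rw [← Real.rpow_mul (hB0 ω)]

/-! ### Hypercontractivity and the Khintchine-Kahane inequality -/

/-- The first inequality does not propagate alone: raising the power produces a multiple of `B * A`
times the difference of the two powers. The second inequality controls this cross term, and the two
are proved by a joint induction. -/
theorem two_point_scalar (A B ρ : ℝ) (hρ : 0 ≤ ρ) (k : ℕ) (hk : ρ ^ 2 * (1 + 4 * k) ≤ 1) :
    ∀ j ≤ k, ((A + ρ * B) ^ (2 * j) + (A - ρ * B) ^ (2 * j) ≤ 2 * (A ^ 2 + B ^ 2) ^ j) ∧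
      B * A * ((A + ρ * B) ^ (2 * j) - (A - ρ * B) ^ (2 * j))
        ≤ 4 * j * ρ * B ^ 2 * (A ^ 2 + B ^ 2) ^ j := by
  intro j
  induction j with
  | zero => intro _; norm_num
  | succ j ih =>
    intro hj
    obtain ⟨h1, h2⟩ := ih (by omega)
    set P := A ^ 2 + B ^ 2 with hP
    have hP0 : 0 ≤ P ^ j := by positivity
    set e := (A + ρ * B) ^ (2 * j) with he
    set d := (A - ρ * B) ^ (2 * j) with hd
    have hjk : ρ ^ 2 * (1 + 4 * j) ≤ 1 := by
      refine le_trans (mul_le_mul_of_nonneg_left ?_ (sq_nonneg ρ)) hk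
      have : (j : ℝ) ≤ k := by exact_mod_cast (by omega : j ≤ k)
      linarith
    have e1 : (A + ρ * B) ^ (2 * (j + 1)) = (A + ρ * B) ^ 2 * e := by rw [he]; ring
    have d1 : (A - ρ * B) ^ (2 * (j + 1)) = (A - ρ * B) ^ 2 * d := by rw [hd]; ring
    rw [e1, d1, pow_succ P j]
    constructor
    -- Both induction hypotheses bound this by `2 * P ^ j * (A ^ 2 + ρ ^ 2 * (1 + 4 * j) * B ^ 2)`,
    -- whence the condition on `ρ`.
    · have : (A + ρ * B) ^ 2 * e + (A - ρ * B) ^ 2 * d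
          = (A ^ 2 + ρ ^ 2 * B ^ 2) * (e + d) + 2 * ρ * (B * A * (e - d)) := by ring
      rw [this]
      have a1 := mul_le_mul_of_nonneg_left h1 (by positivity : 0 ≤ A ^ 2 + ρ ^ 2 * B ^ 2)
      have a2 := mul_le_mul_of_nonneg_left h2 (by positivity : 0 ≤ 2 * ρ)
      have a3 := mul_le_mul_of_nonneg_right hjk (by positivity : 0 ≤ 2 * B ^ 2 * P ^ j)
      have : 2 * (P ^ j * P) = 2 * A ^ 2 * P ^ j + 2 * B ^ 2 * P ^ j := by rw [hP]; ring
      rw [this]; nlinarith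
    · have : B * A * ((A + ρ * B) ^ 2 * e - (A - ρ * B) ^ 2 * d)
          = (A ^ 2 + ρ ^ 2 * B ^ 2) * (B * A * (e - d)) + 2 * ρ * A ^ 2 * B ^ 2 * (e + d) := by
        ring
      rw [this]
      have hρ1 : ρ ^ 2 ≤ 1 := by
        refine le_trans ?_ hjk
        nlinarith [sq_nonneg ρ, (Nat.cast_nonneg j : (0 : ℝ) ≤ j), mul_nonneg (sq_nonneg ρ) (Nat.cast_nonneg j : (0 : ℝ) ≤ j)]
      have a1 := mul_le_mul_of_nonneg_left h2 (by positivity : 0 ≤ A ^ 2 + ρ ^ 2 * B ^ 2)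
      have a2 := mul_le_mul_of_nonneg_left h1 (by positivity : 0 ≤ 2 * ρ * A ^ 2 * B ^ 2)
      have b1 : A ^ 2 + ρ ^ 2 * B ^ 2 ≤ P := by rw [hP]; nlinarith [sq_nonneg B]
      have b2 : A ^ 2 ≤ P := by rw [hP]; nlinarith [sq_nonneg B]
      have a3 := mul_le_mul_of_nonneg_right b1
        (by positivity : 0 ≤ 4 * j * ρ * B ^ 2 * P ^ j)
      have a4 := mul_le_mul_of_nonneg_right b2 (by positivity : 0 ≤ 4 * ρ * B ^ 2 * P ^ j)
      push_cast
      nlinarith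

/-- For `ρ ≤ 1` both `x ± ρ • y` are convex combinations of `x + y` and `x - y`. The triangle
inequality thus reduces to the scalar case, with `A` and `B` the half-sum and half-difference of `‖x
+ y‖` and `‖x - y‖`. -/
theorem two_point_vector {Y : Type*} [NormedAddCommGroup Y] [NormedSpace ℝ Y] (x y : Y) (ρ : ℝ)
    (hρ : 0 ≤ ρ) (k : ℕ) (hk : ρ ^ 2 * (1 + 4 * k) ≤ 1) :
    ‖x + ρ • y‖ ^ (2 * k) + ‖x - ρ • y‖ ^ (2 * k)
      ≤ 2 * ((‖x + y‖ ^ 2 + ‖x - y‖ ^ 2) / 2) ^ k := by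
  have hρ1 : ρ ≤ 1 := by
    have h : ρ ^ 2 ≤ 1 := by
      refine le_trans ?_ hk
      nlinarith [mul_nonneg (sq_nonneg ρ) (Nat.cast_nonneg k : (0 : ℝ) ≤ k)]
    nlinarith
  set u := ‖x + y‖
  set v := ‖x - y‖
  have h := (two_point_scalar ((u + v) / 2) ((u - v) / 2) ρ hρ k hk k le_rfl).1
  have h1 : ‖x + ρ • y‖ ≤ (u + v) / 2 + ρ * ((u - v) / 2) := by
    have e : x + ρ • y = ((1 + ρ) / 2) • (x + y) + ((1 - ρ) / 2) • (x - y) := by module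
    rw [e]
    refine (norm_add_le _ _).trans (le_of_eq ?_)
    rw [norm_smul, norm_smul, Real.norm_of_nonneg (by linarith), Real.norm_of_nonneg (by linarith)]
    ring
  have h2 : ‖x - ρ • y‖ ≤ (u + v) / 2 - ρ * ((u - v) / 2) := by
    have e : x - ρ • y = ((1 - ρ) / 2) • (x + y) + ((1 + ρ) / 2) • (x - y) := by module
    rw [e]
    refine (norm_add_le _ _).trans (le_of_eq ?_)
    rw [norm_smul, norm_smul, Real.norm_of_nonneg (by linarith), Real.norm_of_nonneg (by linarith)]
    ring
  refine le_trans (add_le_add (pow_le_pow_left₀ (norm_nonneg _) h1 _)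
    (pow_le_pow_left₀ (norm_nonneg _) h2 _)) (h.trans (le_of_eq ?_))
  congr 2
  ring

theorem Fin.sum_signs_succ {N : ℕ} (f : (Fin (N + 1) → ℤˣ) → ℝ) :
    ∑ ε, f ε = ∑ ε : Fin N → ℤˣ, (f (Fin.cons 1 ε) + f (Fin.cons (-1) ε)) := by
  rw [← (Fin.consEquiv fun _ => ℤˣ).sum_comp, Fintype.sum_prod_type]
  rw [Finset.sum_comm]
  refine Finset.sum_congr rfl fun ε _ => ?_
  rw [show (Finset.univ : Finset ℤˣ) = {1, -1} from rfl, Finset.sum_pair (by decide)]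
  rfl

/-- Hypercontractivity of Rademacher sums in a normed space. -/
theorem rademacher_hypercontractive (ρ : ℝ) (hρ : 0 ≤ ρ) (k : ℕ)
    (hk : ρ ^ 2 * (1 + 4 * k) ≤ 1) (N : ℕ) :
    ∀ {Y : Type*} [NormedAddCommGroup Y] [NormedSpace ℝ Y] (x : Y) (y : Fin N → Y),
    ((2 : ℝ) ^ N)⁻¹ * ∑ ε : Fin N → ℤˣ, ‖x + ρ • ∑ i, (ε i : ℤ) • y i‖ ^ (2 * k)
      ≤ (((2 : ℝ) ^ N)⁻¹ * ∑ ε : Fin N → ℤˣ, ‖x + ∑ i, (ε i : ℤ) • y i‖ ^ 2) ^ k := by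
  induction N with
  | zero => intro Y _ _ x y; simp [pow_mul]
  | succ N ih =>
    intro Y _ _ x y
    rw [Fin.sum_signs_succ, Fin.sum_signs_succ]
    simp only [Fin.sum_univ_succ, Fin.cons_zero, Fin.cons_succ, Units.val_one, Units.val_neg,
      one_smul, neg_smul]
    set w : (Fin N → ℤˣ) → Y := fun ε => ∑ i, (ε i : ℤ) • y i.succ with hw
    -- The first sign is absorbed into the space: the induction hypothesis is used in the `ℓ^2` sum
    -- `Y ⊕ Y`, which is why `Y` is quantified inside the induction.
    have IH := ih (WithLp.toLp 2 (x + y 0, x - y 0) : WithLp 2 (Y × Y))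
      (fun i => WithLp.toLp 2 (y i.succ, y i.succ))
    have hsum : ∀ ε : Fin N → ℤˣ, (∑ i, (ε i : ℤ) • (WithLp.toLp 2 (y i.succ, y i.succ)
        : WithLp 2 (Y × Y))) = WithLp.toLp 2 (w ε, w ε) := by
      intro ε
      apply (WithLp.ofLp_injective 2)
      rw [WithLp.ofLp_sum]
      simp only [WithLp.ofLp_smul, hw]
      ext <;> simp [Prod.fst_sum, Prod.snd_sum]
    have hnorm : ∀ a b : Y, ‖(WithLp.toLp 2 (a, b) : WithLp 2 (Y × Y))‖ ^ 2
        = ‖a‖ ^ 2 + ‖b‖ ^ 2 := fun a b => WithLp.prod_norm_sq_eq_of_L2 _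
    simp only [hsum] at IH
    simp only [← WithLp.toLp_smul, ← WithLp.toLp_add, Prod.smul_mk, Prod.mk_add_mk, hnorm,
      pow_mul] at IH
    have hpt : ∀ ε : Fin N → ℤˣ, ‖x + ρ • (y 0 + w ε)‖ ^ (2 * k) + ‖x + ρ • (-y 0 + w ε)‖ ^ (2 * k)
        ≤ 2 * (2 ^ k)⁻¹ * (‖x + y 0 + ρ • w ε‖ ^ 2 + ‖x - y 0 + ρ • w ε‖ ^ 2) ^ k := by
      intro ε
      have h := two_point_vector (x + ρ • w ε) (y 0) ρ hρ k hk
      rw [show x + ρ • (y 0 + w ε) = x + ρ • w ε + ρ • y 0 by module,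
        show x + ρ • (-y 0 + w ε) = x + ρ • w ε - ρ • y 0 by module,
        show x + y 0 + ρ • w ε = x + ρ • w ε + y 0 by module,
        show x - y 0 + ρ • w ε = x + ρ • w ε - y 0 by module]
      refine h.trans (le_of_eq ?_)
      rw [div_pow]; ring
    calc _ ≤ ((2 : ℝ) ^ (N + 1))⁻¹ * ∑ ε : Fin N → ℤˣ, 2 * (2 ^ k)⁻¹ *
          (‖x + y 0 + ρ • w ε‖ ^ 2 + ‖x - y 0 + ρ • w ε‖ ^ 2) ^ k :=
          mul_le_mul_of_nonneg_left (Finset.sum_le_sum fun ε _ => hpt ε) (by positivity)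
      _ = (2 ^ k)⁻¹ * (((2 : ℝ) ^ N)⁻¹ * ∑ ε : Fin N → ℤˣ,
          (‖x + y 0 + ρ • w ε‖ ^ 2 + ‖x - y 0 + ρ • w ε‖ ^ 2) ^ k) := by
          rw [← Finset.mul_sum, pow_succ, mul_inv]; ring
      _ ≤ (2 ^ k)⁻¹ * (((2 : ℝ) ^ N)⁻¹ * ∑ ε : Fin N → ℤˣ,
          (‖x + y 0 + w ε‖ ^ 2 + ‖x - y 0 + w ε‖ ^ 2)) ^ k :=
          mul_le_mul_of_nonneg_left IH (by positivity)
      _ = _ := by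
          rw [← inv_pow, ← mul_pow]
          congr 1
          rw [pow_succ, mul_inv, mul_comm ((2 : ℝ) ^ N)⁻¹ 2⁻¹, mul_assoc]
          congr 2
          refine Finset.sum_congr rfl fun ε _ => ?_
          rw [add_assoc x, sub_eq_add_neg, add_assoc x]

/-- The Khintchine-Kahane inequality between an even moment and the first moment. -/
theorem kahane_pow_le {Y : Type*} [NormedAddCommGroup Y] [NormedSpace ℝ Y] (k N : ℕ)
    (y : Fin N → Y) :
    ((2 : ℝ) ^ N)⁻¹ * ∑ ε : Fin N → ℤˣ, ‖∑ i, (ε i : ℤ) • y i‖ ^ (2 * k)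
      ≤ (9 * (4 * k + 1) * (((2 : ℝ) ^ N)⁻¹ * ∑ ε : Fin N → ℤˣ, ‖∑ i, (ε i : ℤ) • y i‖))
        ^ (2 * k) := by
  set Z : (Fin N → ℤˣ) → ℝ := fun ε => ‖∑ i, (ε i : ℤ) • y i‖ with hZ
  have hZ0 : ∀ ε, 0 ≤ Z ε := fun ε => norm_nonneg _
  set w : ℝ := ((2 : ℝ) ^ N)⁻¹ with hw
  have hw0 : 0 < w := by positivity
  have moment : ∀ j : ℕ, ∀ ρ : ℝ, 0 < ρ → ρ ^ 2 * (1 + 4 * j) ≤ 1 →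
      w * ∑ ε, Z ε ^ (2 * j) ≤ (ρ⁻¹) ^ (2 * j) * (w * ∑ ε, Z ε ^ 2) ^ j := by
    intro j ρ hρ hj
    have h := rademacher_hypercontractive ρ hρ.le j hj N (0 : Y) y
    simp only [zero_add] at h
    have e : w * ∑ ε : Fin N → ℤˣ, ‖ρ • ∑ i, (ε i : ℤ) • y i‖ ^ (2 * j)
        = ρ ^ (2 * j) * (w * ∑ ε, Z ε ^ (2 * j)) := by
      simp only [norm_smul, Real.norm_of_nonneg hρ.le, mul_pow, ← Finset.mul_sum, hZ]
      ring
    rw [e] at h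
    rw [inv_pow]
    exact (le_inv_mul_iff₀ (by positivity)).2 h
  set M1 := w * ∑ ε, Z ε with hM1
  set M2 := w * ∑ ε, Z ε ^ 2 with hM2
  set M3 := w * ∑ ε, Z ε ^ 3
  set M4 := w * ∑ ε, Z ε ^ 4
  have hM10 : 0 ≤ M1 := mul_nonneg hw0.le (Finset.sum_nonneg fun ε _ => hZ0 ε)
  have hM20 : 0 ≤ M2 := mul_nonneg hw0.le (Finset.sum_nonneg fun ε _ => by positivity)
  have hM4 : M4 ≤ 81 * M2 ^ 2 := by
    -- `ρ = 1 / 3` is extremal for `j = 2`, and `81 = 3 ^ 4`. With log-convexity of moments this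
    -- bounds the second moment by the first.
    have := moment 2 (1 / 3) (by norm_num) (by norm_num)
    norm_num at this
    exact this
  have h13 : M2 ^ 2 ≤ M1 * M3 := by
    have h := Finset.sum_sq_le_sum_mul_sum_of_sq_le_mul Finset.univ (r := fun ε => Z ε ^ 2)
      (f := Z) (g := fun ε => Z ε ^ 3) (fun ε _ => hZ0 ε) (fun ε _ => pow_nonneg (hZ0 ε) 3)
      (fun ε _ => le_of_eq (by ring))
    calc M2 ^ 2 = w ^ 2 * (∑ ε, Z ε ^ 2) ^ 2 := by rw [hM2]; ring
      _ ≤ w ^ 2 * ((∑ ε, Z ε) * ∑ ε, Z ε ^ 3) := mul_le_mul_of_nonneg_left h (by positivity)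
      _ = M1 * M3 := by ring
  have h24 : M3 ^ 2 ≤ M2 * M4 := by
    have h := Finset.sum_sq_le_sum_mul_sum_of_sq_le_mul Finset.univ (r := fun ε => Z ε ^ 3)
      (f := fun ε => Z ε ^ 2) (g := fun ε => Z ε ^ 4) (fun ε _ => pow_nonneg (hZ0 ε) 2)
      (fun ε _ => pow_nonneg (hZ0 ε) 4) (fun ε _ => le_of_eq (by ring))
    calc M3 ^ 2 = w ^ 2 * (∑ ε, Z ε ^ 3) ^ 2 := by ring
      _ ≤ w ^ 2 * ((∑ ε, Z ε ^ 2) * ∑ ε, Z ε ^ 4) := mul_le_mul_of_nonneg_left h (by positivity)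
      _ = M2 * M4 := by ring
  have hM21 : M2 ≤ 81 * M1 ^ 2 := by
    rcases hM20.eq_or_lt with h | h
    · rw [← h]; positivity
    have h1 : M2 ^ 4 ≤ M1 ^ 2 * (M2 * (81 * M2 ^ 2)) := by
      calc M2 ^ 4 = (M2 ^ 2) ^ 2 := by ring
        _ ≤ (M1 * M3) ^ 2 := pow_le_pow_left₀ (by positivity) h13 2
        _ = M1 ^ 2 * M3 ^ 2 := by ring
        _ ≤ M1 ^ 2 * (M2 * M4) := mul_le_mul_of_nonneg_left h24 (by positivity)
        _ ≤ _ := mul_le_mul_of_nonneg_left (mul_le_mul_of_nonneg_left hM4 hM20) (by positivity)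
    have h2 : M2 ^ 3 * M2 ≤ M2 ^ 3 * (81 * M1 ^ 2) := by linarith
    exact le_of_mul_le_mul_left h2 (by positivity)
  have hk0 : (0 : ℝ) < 4 * k + 1 := by positivity
  have hmk := moment k (4 * k + 1 : ℝ)⁻¹ (by positivity) (by
    rw [inv_pow, inv_mul_le_iff₀ (by positivity)]; nlinarith)
  rw [inv_inv] at hmk
  calc w * ∑ ε, Z ε ^ (2 * k) ≤ _ := hmk
    _ ≤ (4 * k + 1 : ℝ) ^ (2 * k) * (81 * M1 ^ 2) ^ k :=
        mul_le_mul_of_nonneg_left (pow_le_pow_left₀ hM20 hM21 k) (by positivity)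
    _ = (9 * (4 * k + 1) * M1) ^ (2 * k) := by
        rw [show (81 : ℝ) * M1 ^ 2 = (9 * M1) ^ 2 by ring, ← pow_mul, ← mul_pow]; ring

/-- In a space of cotype `q`, the `q`-th moment of a Rademacher sum may be replaced by the first. -/
theorem HasCotype.exists_sum_rpow_le {Y : Type*} [NormedAddCommGroup Y] [NormedSpace ℝ Y] {q : ℝ}
    (h : HasCotype Y q) :
    ∃ K : ℝ, 0 ≤ K ∧ ∀ (N : ℕ) (x : Fin N → Y), ∑ i, ‖x i‖ ^ q
      ≤ (K * ((Fintype.card (Fin N → ℤˣ) : ℝ)⁻¹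
          * ∑ ε : Fin N → ℤˣ, ‖∑ i, (ε i : ℤ) • x i‖)) ^ q := by
  obtain ⟨hq, K, hK⟩ := h
  have hq0 : 0 < q := by linarith
  obtain ⟨k, hk⟩ := exists_nat_ge q
  have hkq : q ≤ ((2 * k : ℕ) : ℝ) := by push_cast; linarith
  have hk0 : (0 : ℝ) < ((2 * k : ℕ) : ℝ) := by linarith
  refine ⟨max K 0 * (9 * (4 * k + 1)), by positivity, fun N x => ?_⟩
  have hcard : (Fintype.card (Fin N → ℤˣ) : ℝ) = 2 ^ N := by simp
  rw [hcard]
  set w : ℝ := ((2 : ℝ) ^ N)⁻¹ with hw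
  have hw0 : 0 < w := by positivity
  have hw1 : ∑ _ε : Fin N → ℤˣ, w = 1 := by
    rw [Finset.sum_const, Finset.card_univ, nsmul_eq_mul, hcard, hw, mul_inv_cancel₀ (by positivity)]
  set Z : (Fin N → ℤˣ) → ℝ := fun ε => ‖∑ i, (ε i : ℤ) • x i‖ with hZ
  have hZ0 : ∀ ε, 0 ≤ Z ε := fun ε => norm_nonneg _
  have hZq : 0 ≤ w * ∑ ε, Z ε ^ q := mul_nonneg hw0.le
    (Finset.sum_nonneg fun ε _ => Real.rpow_nonneg (hZ0 ε) _)
  have hS : 0 ≤ w * ∑ ε, Z ε := mul_nonneg hw0.le (Finset.sum_nonneg fun ε _ => hZ0 ε)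
  have hX : 0 ≤ ∑ i, ‖x i‖ ^ q := Finset.sum_nonneg fun i _ => by positivity
  have h1 : (w * ∑ ε, Z ε ^ q) ^ (1 / q) ≤ 9 * (4 * k + 1) * (w * ∑ ε, Z ε) := by
    have hp : (1 : ℝ) ≤ ((2 * k : ℕ) : ℝ) / q := (one_le_div hq0).2 hkq
    have hj := Real.rpow_arith_mean_le_arith_mean_rpow Finset.univ (fun _ => w)
      (fun ε => Z ε ^ q) (fun _ _ => hw0.le) hw1 (fun ε _ => Real.rpow_nonneg (hZ0 ε) _) hp
    simp only [← Finset.mul_sum] at hj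
    have hj2 : (w * ∑ ε, Z ε ^ q) ^ (((2 * k : ℕ) : ℝ) / q)
        ≤ (9 * (4 * k + 1) * (w * ∑ ε, Z ε)) ^ (2 * k) := by
      refine hj.trans (le_trans (le_of_eq ?_) (kahane_pow_le k N x))
      congr 1
      refine Finset.sum_congr rfl fun ε _ => ?_
      rw [← Real.rpow_mul (hZ0 ε), mul_div_cancel₀ _ hq0.ne', Real.rpow_natCast]
    have hj3 := Real.rpow_le_rpow (Real.rpow_nonneg hZq _) hj2 (inv_nonneg.2 hk0.le)
    rw [Real.pow_rpow_inv_natCast (by positivity) (by intro h; rw [h] at hk0; simp at hk0),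
      ← Real.rpow_mul hZq] at hj3
    refine le_of_eq_of_le ?_ hj3
    congr 1
    field_simp
  have h2 : (∑ i, ‖x i‖ ^ q) ^ (1 / q) ≤ max K 0 * (9 * (4 * k + 1)) * (w * ∑ ε, Z ε) := by
    refine (hK N x).trans ?_
    rw [mul_assoc]
    exact mul_le_mul (le_max_left _ _) h1 (Real.rpow_nonneg hZq _) (le_max_right _ _)
  have h3 := Real.rpow_le_rpow (Real.rpow_nonneg hX _) h2 hq0.le
  rwa [← Real.rpow_mul hX, one_div_mul_cancel hq0.ne', Real.rpow_one] at h3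

/-! ### Finite families and uniform boundedness of the summing constants -/

/-- The finite family `x` has weak `ℓ^p` norm at most one. -/
def UnitWeak (𝕜 : Type*) [RCLike 𝕜] {E : Type*} [NormedAddCommGroup E] [NormedSpace 𝕜 E]
    {α : Type*} [Fintype α] (p : ℝ) (x : α → E) : Prop :=
  ∀ φ : StrongDual 𝕜 E, ‖φ‖ ≤ 1 → ∑ t, ‖φ (x t)‖ ^ p ≤ 1

/-- The family obtained from `z` by replacing the coordinates in `C` by `x j (u j)`. -/
def glue {ι : Type*} [DecidableEq ι] {X : ι → Type*} {α : Type*} (C : Finset ι)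
    (x : ∀ j, α → X j) (z : ∀ j, X j) (u : C → α) : ∀ j, X j :=
  fun j => if h : j ∈ C then x j (u ⟨j, h⟩) else z j

theorem glue_update {ι : Type*} [DecidableEq ι] {X : ι → Type*} {α : Type*} {C : Finset ι}
    (x : ∀ j, α → X j) (z : ∀ j, X j) (u : C → α) {a : ι} (ha : a ∉ C) (v : X a) :
    glue C x (Function.update z a v) u = Function.update (glue C x z u) a v := by
  ext j
  rcases eq_or_ne j a with rfl | h
  · simp [glue, ha]
  · simp [glue, h]

/-- The seminorm `v ↦ (∑ ‖f u v‖ ^ r) ^ (1 / r)` of a finite family of linear maps. -/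
noncomputable def lpSeminorm {𝕜 E Y U : Type*} [RCLike 𝕜] [NormedAddCommGroup E]
    [NormedSpace 𝕜 E] [NormedAddCommGroup Y] [NormedSpace 𝕜 Y] [Fintype U] (r : ℝ) (hr : 1 ≤ r)
    (f : U → E →ₗ[𝕜] Y) : Seminorm 𝕜 E :=
  Seminorm.of (fun v => (∑ u, ‖f u v‖ ^ r) ^ (1 / r))
    (fun v w => by
      refine le_trans (Real.rpow_le_rpow (by positivity) (Finset.sum_le_sum fun u _ =>
        Real.rpow_le_rpow (norm_nonneg _) ?_ (by linarith)) (by positivity))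
        (Real.Lp_add_le_of_nonneg (s := Finset.univ) (f := fun u => ‖f u v‖)
          (g := fun u => ‖f u w‖) hr (fun _ _ => norm_nonneg _) (fun _ _ => norm_nonneg _))
      rw [map_add]; exact norm_add_le _ _)
    (fun c v => by
      have hr0 : r ≠ 0 := by linarith
      simp only [map_smul, norm_smul]
      simp only [Real.mul_rpow (norm_nonneg _) (norm_nonneg _), ← Finset.mul_sum]
      rw [Real.mul_rpow (by positivity) (by positivity), ← Real.rpow_mul (norm_nonneg _),
        mul_one_div_cancel hr0, Real.rpow_one])

theorem lpSeminorm_apply {𝕜 E Y U : Type*} [RCLike 𝕜] [NormedAddCommGroup E]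
    [NormedSpace 𝕜 E] [NormedAddCommGroup Y] [NormedSpace 𝕜 Y] [Fintype U] (r : ℝ) (hr : 1 ≤ r)
    (f : U → E →ₗ[𝕜] Y) (v : E) :
    lpSeminorm r hr f v = (∑ u, ‖f u v‖ ^ r) ^ (1 / r) := rfl

section
variable {𝕜 : Type*} [RCLike 𝕜] {ι : Type*} [DecidableEq ι] {X : ι → Type*}
  [∀ j, NormedAddCommGroup (X j)] [∀ j, NormedSpace 𝕜 (X j)]
  {Y : Type*} [NormedAddCommGroup Y] [NormedSpace 𝕜 Y]

/-- The uniform boundedness principle for the multiple summing constants of `z ↦ T(·, z)`. -/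
theorem exists_uniform_sum_le [∀ j, CompleteSpace (X j)] (T : MultilinearMap 𝕜 X Y)
    (hsep : ∀ z j, Continuous fun v => T (Function.update z j v))
    (C : Finset ι) {r : ℝ} (hr : 1 ≤ r) (p : ℝ)
    (hC : ∀ z : ∀ j, X j, ∃ K : ℝ, ∀ (N : ℕ) (x : ∀ j, Fin N → X j),
      (∀ j ∈ C, UnitWeak 𝕜 p (x j)) → ∑ u : C → Fin N, ‖T (glue C x z u)‖ ^ r ≤ K)
    (S : Finset ι) (hS : Disjoint S C) :
    ∀ z : ∀ j, X j, ∃ K : ℝ, ∀ z' : ∀ j, X j, (∀ j ∈ S, ‖z' j‖ ≤ 1) → (∀ j ∉ S, z' j = z j) →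
      ∀ (N : ℕ) (x : ∀ j, Fin N → X j), (∀ j ∈ C, UnitWeak 𝕜 p (x j)) →
        ∑ u : C → Fin N, ‖T (glue C x z' u)‖ ^ r ≤ K := by
  induction S using Finset.induction_on with
  | empty =>
    intro z
    obtain ⟨K, hK⟩ := hC z
    refine ⟨K, fun z' _ hz' N x hx => ?_⟩
    rw [show z' = z from funext fun j => hz' j (by simp)]
    exact hK N x hx
  | insert a S haS ih =>
    intro z
    rw [Finset.disjoint_insert_left] at hS
    have ih := ih hS.2
    have hr0 : 0 < r := by linarith
    -- All finite families together with all choices of the coordinates in `S`. The coordinate `a`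
    -- of `w.1` is irrelevant, being overwritten by the variable `v`.
    let Idx := Σ N : ℕ, {w : (∀ j, X j) × (∀ j, Fin N → X j) //
      ((∀ j ∈ S, ‖w.1 j‖ ≤ 1) ∧ ∀ j, j ∉ S → j ≠ a → w.1 j = z j) ∧ ∀ j ∈ C, UnitWeak 𝕜 p (w.2 j)}
    let P : Idx → Seminorm 𝕜 (X a) := fun i => lpSeminorm r hr
      fun u : C → Fin i.1 => T.toLinearMap (glue C i.2.1.2 i.2.1.1 u) a
    have hP : ∀ i v, P i v = (∑ u : C → Fin i.1,
        ‖T (glue C i.2.1.2 (Function.update i.2.1.1 a v) u)‖ ^ r) ^ (1 / r) := by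
      intro i v
      simp only [P, lpSeminorm_apply, glue_update _ _ _ hS.1]
      rfl
    have hPc : ∀ i, Continuous (P i) := by
      intro i
      have : (P i : X a → ℝ) = fun v => (∑ u : C → Fin i.1,
        ‖T (Function.update (glue C i.2.1.2 i.2.1.1 u) a v)‖ ^ r) ^ (1 / r) := by
        ext v; rw [hP]; simp only [glue_update _ _ _ hS.1]
      rw [this]
      refine Continuous.rpow_const (continuous_finsetSum _ fun u _ => ?_)
        fun _ => Or.inr (by positivity)
      exact Continuous.rpow_const (hsep _ _).norm fun _ => Or.inr hr0.le
    have hbdd : ∀ v, ∃ K : ℝ, ∀ i, P i v ≤ K := by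
      intro v
      obtain ⟨K, hK⟩ := ih (Function.update z a v)
      refine ⟨K ^ (1 / r), fun i => ?_⟩
      rw [hP]
      refine Real.rpow_le_rpow (by positivity) ?_ (by positivity)
      refine hK _ (fun j hj => ?_) (fun j hj => ?_) _ _ i.2.2.2
      · rw [Function.update_of_ne (by rintro rfl; exact haS hj)]
        exact i.2.2.1.1 j hj
      · rcases eq_or_ne j a with rfl | hja
        · simp
        · rw [Function.update_of_ne hja, Function.update_of_ne hja]
          exact i.2.2.1.2 j hj hja
    have hB : BddAbove (Set.range P) := by
      rw [Seminorm.bddAbove_range_iff]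
      intro v
      obtain ⟨K, hK⟩ := hbdd v
      exact ⟨K, by rintro _ ⟨i, rfl⟩; exact hK i⟩
    -- Banach-Steinhaus: completeness of `X a` makes the supremum of pointwise bounded continuous
    -- seminorms continuous.
    have hcont := Seminorm.continuous_iSup P hPc hB
    rw [← Seminorm.coe_iSup_eq hB] at hcont
    obtain ⟨K, hK0, hK⟩ := Seminorm.bound_of_continuous_normedSpace _ hcont
    refine ⟨K ^ r, fun z' hz' hz N x hx => ?_⟩
    let i : Idx := ⟨N, (z', x), ⟨fun j hj => hz' j (Finset.mem_insert_of_mem hj),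
      fun j hj hja => hz j (by simp [hj, hja])⟩, hx⟩
    have h1 : P i (z' a) ≤ K := by
      have h2 : P i ≤ ⨆ i, P i := le_ciSup hB i
      refine (h2 (z' a)).trans ((hK (z' a)).trans ?_)
      exact mul_le_of_le_one_right hK0.le (hz' a (Finset.mem_insert_self _ _))
    rw [hP] at h1
    have h3 := Real.rpow_le_rpow (by positivity) h1 hr0.le
    rw [← Real.rpow_mul (by positivity), one_div_mul_cancel hr0.ne', Real.rpow_one] at h3
    simpa [i] using h3

end

/-! ### From cotype to mixed sums -/

/-- Test on a norming functional. This allows a Rademacher sum to be inserted as a fixed vector in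
an estimate that is uniform over the unit ball. -/
theorem UnitWeak.norm_sum_signs_le {𝕜 E : Type*} [RCLike 𝕜] [NormedAddCommGroup E]
    [NormedSpace 𝕜 E] {N : ℕ} {x : Fin N → E} (hx : UnitWeak 𝕜 1 x) (ε : Fin N → ℤˣ) :
    ‖∑ t, (ε t : ℤ) • x t‖ ≤ 1 := by
  obtain ⟨φ, hφ, h⟩ := exists_dual_vector'' 𝕜 (∑ t, (ε t : ℤ) • x t)
  have h1 : ‖∑ t, (ε t : ℤ) • x t‖ = ‖φ (∑ t, (ε t : ℤ) • x t)‖ := by rw [h]; simp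
  rw [h1, map_sum]
  refine (norm_sum_le _ _).trans (le_trans (Finset.sum_le_sum fun t _ => ?_) (hx φ hφ))
  rw [Real.rpow_one, map_zsmul]
  rcases Int.units_eq_one_or (ε t) with h | h <;> simp [h]

/-- Hölder with exponents `p` and `p^*`; the origin of every `1 / p^*` in the final exponents. -/
theorem UnitWeak.smul_rpow {𝕜 E : Type*} [RCLike 𝕜] [NormedAddCommGroup E]
    [NormedSpace 𝕜 E] {α : Type*} [Fintype α] {p : ℝ} (hp : 1 ≤ p) {x : α → E}
    (hx : UnitWeak 𝕜 p x) {g : α → ℝ} (hg : ∀ t, 0 ≤ g t) (hg1 : ∑ t, g t ≤ 1) :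
    UnitWeak 𝕜 1 fun t => ((g t ^ invConj p : ℝ) : 𝕜) • x t := by
  intro φ hφ
  have hp0 : 0 < p := by linarith
  have h0 : 0 ≤ 1 / p := by positivity
  have h1 : 1 / p ≤ 1 := by rw [div_le_one hp0]; exact hp
  refine le_trans (le_of_eq ?_) ((Finset.sum_rpow_mul_rpow_le Finset.univ
    (fun t => ‖φ (x t)‖ ^ p) g (fun t => by positivity) hg h0 h1).trans ?_)
  · refine Finset.sum_congr rfl fun t _ => ?_
    rw [Real.rpow_one, map_smul, norm_smul, RCLike.norm_ofReal,
      abs_of_nonneg (Real.rpow_nonneg (hg t) _), ← Real.rpow_mul (norm_nonneg _),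
      mul_one_div_cancel hp0.ne', Real.rpow_one, mul_comm, invConj]
  · exact mul_le_one₀ (Real.rpow_le_one (by positivity) (hx φ hφ) h0)
      (Real.rpow_nonneg (Finset.sum_nonneg fun t _ => hg t) _)
      (Real.rpow_le_one (Finset.sum_nonneg fun t _ => hg t) hg1 (by linarith))

theorem Finset.sum_filter_eq_off_insert {ι α M : Type*} [Fintype ι] [DecidableEq ι] [Fintype α]
    [DecidableEq α] [AddCommMonoid M] (S : Finset ι) {a : ι} (ha : a ∉ S) (e : ι → α)
    (f : (ι → α) → M) :
    ∑ i with ∀ j ∉ insert a S, i j = e j, f i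
      = ∑ i with ∀ j ∉ S, i j = e j, ∑ t, f (Function.update i a t) := by
  rw [← Finset.sum_product']
  refine Finset.sum_nbij' (fun i => (Function.update i a (e a), i a))
    (fun w => Function.update w.1 a w.2) ?_ ?_ ?_ ?_ ?_
  · intro i hi
    simp only [Finset.mem_filter, Finset.mem_univ, true_and, Finset.mem_product, and_true] at hi ⊢
    intro j hj
    rcases eq_or_ne j a with rfl | h
    · simp
    · rw [Function.update_of_ne h]
      exact hi j (by simp [h, hj])
  · intro w hw
    simp only [Finset.mem_filter, Finset.mem_univ, true_and, Finset.mem_product, and_true] at hw ⊢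
    intro j hj
    rw [Finset.mem_insert, not_or] at hj
    rw [Function.update_of_ne hj.1]
    exact hw j hj.2
  · intro i _; simp
  · intro w hw
    simp only [Finset.mem_filter, Finset.mem_univ, true_and, Finset.mem_product, and_true] at hw
    ext1
    · simp only [Function.update_idem]
      rw [← hw a ha, Function.update_eq_self]
    · simp
  · intro i _; simp

section
variable {𝕜 : Type*} [RCLike 𝕜] {ι : Type*} [Fintype ι] [DecidableEq ι] {X : ι → Type*}
  [∀ j, NormedAddCommGroup (X j)] [∀ j, NormedSpace 𝕜 (X j)]
  {Y : Type*} [NormedAddCommGroup Y] [NormedSpace 𝕜 Y]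

/-- In a space of cotype `q`, a map which is uniformly summing in the coordinates of `C` satisfies
a mixed `ℓ^r(ℓ^q)` estimate, with weak `ℓ^1` norms outside `C`. -/
theorem exists_mixed_sum_le (T : MultilinearMap 𝕜 X Y) (C : Finset ι) {q r p : ℝ} (hr : 1 ≤ r)
    (hrq : r ≤ q) {c : ℝ} (hc : 0 ≤ c)
    (hcot : ∀ (N : ℕ) (y : Fin N → Y), ∑ i, ‖y i‖ ^ q
      ≤ (c * ((Fintype.card (Fin N → ℤˣ) : ℝ)⁻¹
          * ∑ ε : Fin N → ℤˣ, ‖∑ i, (ε i : ℤ) • y i‖)) ^ q)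
    {K : ℝ} (hK : ∀ z : ∀ j, X j, (∀ j ∉ C, ‖z j‖ ≤ 1) →
      ∀ (N : ℕ) (x : ∀ j, Fin N → X j), (∀ j ∈ C, UnitWeak 𝕜 p (x j)) →
        ∑ u : C → Fin N, ‖T (glue C x z u)‖ ^ r ≤ K) :
    ∃ K' : ℝ, ∀ (N : ℕ) (x : ∀ j, Fin (N + 1) → X j), (∀ j ∈ C, UnitWeak 𝕜 p (x j)) →
      (∀ j ∉ C, UnitWeak 𝕜 1 (x j)) →
      ∑ u : C → Fin (N + 1), (∑ i : ι → Fin (N + 1) with C.restrict i = u,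
        ‖T fun j => x j (i j)‖ ^ q) ^ (r / q) ≤ K' := by
  have hr0 : 0 < r := by linarith
  have hq0 : 0 < q := by linarith
  -- `S` is the set of coordinates outside `C` already summed in `ℓ^q`. The others carry the fixed
  -- vectors `z j`, and their indices are pinned to `0` so that each term is counted once; hence
  -- `Fin (N + 1)`. Each new coordinate costs a factor `c ^ r`.
  have claim : ∀ S : Finset ι, Disjoint S C → ∀ z : ∀ j, X j, (∀ j ∉ C, ‖z j‖ ≤ 1) →
      ∀ (N : ℕ) (x : ∀ j, Fin (N + 1) → X j), (∀ j ∈ C, UnitWeak 𝕜 p (x j)) →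
      (∀ j ∉ C, UnitWeak 𝕜 1 (x j)) →
      ∑ u : C → Fin (N + 1), (∑ i : ι → Fin (N + 1) with
        ∀ j ∉ S, i j = if h : j ∈ C then u ⟨j, h⟩ else 0,
        ‖T fun j => if j ∈ C ∪ S then x j (i j) else z j‖ ^ q) ^ (r / q)
        ≤ (c ^ r) ^ S.card * K := by
    intro S
    induction S using Finset.induction_on with
    | empty =>
      intro _ z hz N x hx _
      refine le_trans (le_of_eq ?_) ((hK z hz _ x hx).trans (le_of_eq (by simp)))
      refine Finset.sum_congr rfl fun u _ => ?_
      have : (Finset.univ.filter fun i : ι → Fin (N + 1) =>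
          ∀ j ∉ (∅ : Finset ι), i j = if h : j ∈ C then u ⟨j, h⟩ else 0)
          = {fun j => if h : j ∈ C then u ⟨j, h⟩ else 0} := by
        ext i; simp [funext_iff]
      rw [this, Finset.sum_singleton, ← Real.rpow_mul (norm_nonneg _),
        mul_div_cancel₀ _ hq0.ne']
      congr 3
      ext j
      by_cases h : j ∈ C <;> simp [glue, h]
    | insert a S haS ih =>
      intro hS z hz N x hx hx1
      rw [Finset.disjoint_insert_left] at hS
      have ih := ih hS.2
      set F : (C → Fin (N + 1)) → Finset (ι → Fin (N + 1)) := fun u =>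
        {i | ∀ j ∉ S, i j = if h : j ∈ C then u ⟨j, h⟩ else 0} with hF
      let v : (Fin (N + 1) → ℤˣ) → X a := fun ε => ∑ t, (ε t : ℤ) • x a t
      have hv : ∀ ε, ‖v ε‖ ≤ 1 := fun ε => (hx1 a hS.1).norm_sum_signs_le ε
      let base : (ι → Fin (N + 1)) → ∀ j, X j := fun i j => if j ∈ C ∪ S then x j (i j) else z j
      have haCS : a ∉ C ∪ S := by simp [hS.1, haS]
      have hupd : ∀ (i : ι → Fin (N + 1)) (t : Fin (N + 1)),
          (fun j => if j ∈ C ∪ insert a S then x j (Function.update i a t j) else z j)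
            = Function.update (base i) a (x a t) := by
        intro i t
        ext j
        rcases eq_or_ne j a with rfl | h
        · simp
        · simp [base, h]
      have hbase : ∀ (i : ι → Fin (N + 1)) (w : X a),
          (fun j => if j ∈ C ∪ S then x j (i j) else Function.update z a w j)
            = Function.update (base i) a w := by
        intro i w
        ext j
        rcases eq_or_ne j a with rfl | h
        · simp [haCS]
        · simp [base, h]
      have hcoti : ∀ i, ∑ t, ‖T (Function.update (base i) a (x a t))‖ ^ q
          ≤ c ^ q * ((Fintype.card (Fin (N + 1) → ℤˣ) : ℝ)⁻¹
            * ∑ ε, ‖T (Function.update (base i) a (v ε))‖) ^ q := by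
        intro i
        refine (hcot _ fun t => T (Function.update (base i) a (x a t))).trans (le_of_eq ?_)
        rw [Real.mul_rpow hc (by positivity)]
        congr 4
        ext ε
        congr 1
        change _ = T.toLinearMap (base i) a (v ε)
        simp only [v, map_sum, map_zsmul]
        rfl
      calc _ = ∑ u : C → Fin (N + 1),
            (∑ i ∈ F u, ∑ t, ‖T (Function.update (base i) a (x a t))‖ ^ q) ^ (r / q) := by
            refine Finset.sum_congr rfl fun u _ => ?_
            rw [Finset.sum_filter_eq_off_insert S haS]
            simp only [hupd, hF]
        _ ≤ ∑ u : C → Fin (N + 1), (∑ i ∈ F u, c ^ q *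
              ((Fintype.card (Fin (N + 1) → ℤˣ) : ℝ)⁻¹
                * ∑ ε, ‖T (Function.update (base i) a (v ε))‖) ^ q) ^ (r / q) :=
            Finset.sum_le_sum fun u _ => Real.rpow_le_rpow (by positivity)
              (Finset.sum_le_sum fun i _ => hcoti i) (by positivity)
        _ = c ^ r * ∑ u : C → Fin (N + 1), (∑ i ∈ F u,
              ((Fintype.card (Fin (N + 1) → ℤˣ) : ℝ)⁻¹
                * ∑ ε, ‖T (Function.update (base i) a (v ε))‖) ^ q) ^ (r / q) := by
            rw [Finset.mul_sum]
            refine Finset.sum_congr rfl fun u _ => ?_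
            rw [← Finset.mul_sum, Real.mul_rpow (by positivity) (by positivity),
              ← Real.rpow_mul hc, mul_div_cancel₀ _ hq0.ne']
        _ ≤ c ^ r * ((Fintype.card (Fin (N + 1) → ℤˣ) : ℝ)⁻¹ * ∑ ε, ∑ u : C → Fin (N + 1),
              (∑ i ∈ F u, ‖T (Function.update (base i) a (v ε))‖ ^ q) ^ (r / q)) :=
            mul_le_mul_of_nonneg_left (sum_rpow_sum_average_le F
              (fun _ i ε => ‖T (Function.update (base i) a (v ε))‖)
              (fun _ _ _ => norm_nonneg _) hr hrq) (by positivity)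
        _ ≤ c ^ r * ((Fintype.card (Fin (N + 1) → ℤˣ) : ℝ)⁻¹ *
              ∑ _ε : Fin (N + 1) → ℤˣ, (c ^ r) ^ S.card * K) := by
            refine mul_le_mul_of_nonneg_left (mul_le_mul_of_nonneg_left
              (Finset.sum_le_sum fun ε _ => ?_) (by positivity)) (by positivity)
            -- For fixed signs, the signed sum `v ε` plays the role of a fixed vector of the unit
            -- ball.
            have h := ih (Function.update z a (v ε)) (fun j hj => ?_) N x hx hx1
            · simpa only [hbase] using h
            · rcases eq_or_ne j a with rfl | hja
              · simpa using hv ε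
              · rw [Function.update_of_ne hja]; exact hz j hj
        _ = _ := by
            rw [Finset.sum_const, Finset.card_univ, nsmul_eq_mul, ← mul_assoc _ _ (_ * K),
              inv_mul_cancel₀ (by exact_mod_cast Fintype.card_ne_zero), one_mul,
              Finset.card_insert_of_notMem haS, pow_succ]
            ring
  refine ⟨_, fun N x hx hx1 => le_trans (le_of_eq ?_)
    (claim (Finset.univ \ C) Finset.sdiff_disjoint (fun _ => 0) (by simp) N x hx hx1)⟩
  refine Finset.sum_congr rfl fun u _ => ?_
  congr 1
  refine Finset.sum_congr ?_ fun i _ => by simp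
  ext i
  simp only [Finset.mem_filter, Finset.mem_univ, true_and, Finset.mem_sdiff, not_not]
  constructor
  · rintro rfl j hj; simp [hj]
  · intro h; ext1 j
    rw [Finset.restrict, h j j.2]; simp

end

/-! ### Mixed bounds and their interpolation -/

theorem invConj_nonneg {p : ℝ} (hp : 1 ≤ p) : 0 ≤ invConj p := by
  have : 1 / p ≤ 1 := by rw [div_le_one (by linarith)]; exact hp
  rw [invConj]; linarith

theorem exists_pos_le_rpow (K : ℝ) {r : ℝ} (hr : 0 < r) : ∃ M : ℝ, 0 < M ∧ ∀ M' ≥ M, K ≤ M' ^ r := by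
  refine ⟨max 1 (|K| ^ (1 / r)), by positivity, fun M' hM' => ?_⟩
  calc K ≤ |K| := le_abs_self K
    _ = (|K| ^ (1 / r)) ^ r := by
      rw [← Real.rpow_mul (abs_nonneg _), one_div_mul_cancel hr.ne', Real.rpow_one]
    _ ≤ M' ^ r := Real.rpow_le_rpow (by positivity) ((le_max_right _ _).trans hM') hr.le

theorem Finset.sum_rpow_le_rpow_sum {β : Type*} (s : Finset β) (f : β → ℝ) (hf : ∀ b, 0 ≤ f b)
    {p : ℝ} (hp : 1 ≤ p) : ∑ b ∈ s, f b ^ p ≤ (∑ b ∈ s, f b) ^ p := by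
  classical
  induction s using Finset.induction_on with
  | empty => simp [Real.zero_rpow (by linarith : p ≠ 0)]
  | insert a s ha ih =>
    rw [Finset.sum_insert ha, Finset.sum_insert ha]
    exact (add_le_add le_rfl ih).trans
      (Real.add_rpow_le_rpow_add (hf a) (Finset.sum_nonneg fun b _ => hf b) hp)

section
variable {𝕜 : Type*} [RCLike 𝕜] {ι : Type*} [Fintype ι] [DecidableEq ι] {X : ι → Type*}
  [∀ j, NormedAddCommGroup (X j)] [∀ j, NormedSpace 𝕜 (X j)]
  {Y : Type*} [NormedAddCommGroup Y] [NormedSpace 𝕜 Y]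

/-- Multiplying the families with index in `D` by weights turns weak `ℓ^p` bounds into weak `ℓ^1`
bounds. -/
theorem exists_weighted (T : MultilinearMap 𝕜 X Y) {α : Type*} [Fintype α] (D : Finset ι)
    {P : ι → ℝ} (hP : ∀ j ∈ D, 1 ≤ P j) {x : ∀ j, α → X j}
    (hx : ∀ j ∈ D, UnitWeak 𝕜 (P j) (x j)) (g : ι → α → ℝ) (hg : ∀ j t, 0 ≤ g j t)
    (hg1 : ∀ j ∈ D, ∑ t, g j t ≤ 1) :
    ∃ x' : ∀ j, α → X j, (∀ j ∈ D, UnitWeak 𝕜 1 (x' j)) ∧ (∀ j ∉ D, x' j = x j) ∧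
      ∀ (i : ι → α) (H : ℝ), 0 ≤ H → (∀ j ∈ D, H ≤ g j (i j)) →
        H ^ (∑ j ∈ D, invConj (P j)) * ‖T fun j => x j (i j)‖ ≤ ‖T fun j => x' j (i j)‖ := by
  let c : ι → α → ℝ := fun j t => if j ∈ D then g j t ^ invConj (P j) else 1
  refine ⟨fun j t => (c j t : 𝕜) • x j t, fun j hj => ?_, fun j hj => ?_, fun i H hH h => ?_⟩
  · simpa only [c, if_pos hj] using (hx j hj).smul_rpow (hP j hj) (hg j) (hg1 j hj)
  · ext t; simp [c, hj]
  · rw [T.map_smul_univ (fun j => (c j (i j) : 𝕜)) fun j => x j (i j), norm_smul, norm_prod]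
    refine mul_le_mul_of_nonneg_right ?_ (norm_nonneg _)
    have e : ∏ j, ‖(c j (i j) : 𝕜)‖ = ∏ j ∈ D, g j (i j) ^ invConj (P j) := by
      rw [← Finset.prod_subset (Finset.subset_univ D) fun j _ hj => by simp [c, hj]]
      refine Finset.prod_congr rfl fun j hj => ?_
      rw [RCLike.norm_ofReal]
      simp only [c, if_pos hj]
      exact abs_of_nonneg (Real.rpow_nonneg (hg j _) _)
    rw [e, Real.rpow_sum_of_nonneg hH fun j hj => invConj_nonneg (hP j hj)]
    exact Finset.prod_le_prod (fun j _ => Real.rpow_nonneg hH _) fun j hj =>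
      Real.rpow_le_rpow hH (h j hj) (invConj_nonneg (hP j hj))

/-- The mixed `ℓ^γ(ℓ^q)` sum of `T` (`ℓ^γ` in the block `k`, `ℓ^q` in the other coordinates) is
bounded by `K` for families with weak `ℓ^{p_l}` norm at most one in the blocks `l ∈ L` and
weak `ℓ^1` norm at most one in the other coordinates. -/
def MixedBound (T : MultilinearMap 𝕜 X Y) {n : ℕ} (C : Fin n → Finset ι) (p : Fin n → ℝ) (q : ℝ)
    (k : Fin n) (γ : ℝ) (L : Finset (Fin n)) (K : ℝ) : Prop :=
  ∀ (N : ℕ) (x : ∀ j, Fin (N + 1) → X j), (∀ l ∈ L, ∀ j ∈ C l, UnitWeak 𝕜 (p l) (x j)) →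
    (∀ j, (∀ l ∈ L, j ∉ C l) → UnitWeak 𝕜 1 (x j)) →
    ∑ u : C k → Fin (N + 1), (∑ i : ι → Fin (N + 1) with (C k).restrict i = u,
      ‖T fun j => x j (i j)‖ ^ q) ^ (γ / q) ≤ K

/-- This supplies the weighted hypotheses of `sum_rpow_sum_le_one_of_weighted`. A weight on the
multi-indices of block `l` is dominated by each of its marginals; putting the marginals, to the
power `1 / p_l^*`, on the vectors of the block passes to weak `ℓ^1` norms there, and their product
is at least `w ^ (|C_l| / p_l^*)`. -/
theorem MixedBound.sum_weighted_le_one {T : MultilinearMap 𝕜 X Y} {n : ℕ} {C : Fin n → Finset ι}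
    {p : Fin n → ℝ} {q : ℝ} {k l : Fin n} {γ : ℝ} {L : Finset (Fin n)} {K : ℝ}
    (hCdisj : ∀ k l, k ≠ l → Disjoint (C k) (C l)) (hp : ∀ k, 1 ≤ p k) (hq : 0 < q) (hγ : 0 < γ)
    (h : MixedBound T C p q k γ (L.erase l) K) (hl : l ∈ L) {M : ℝ} (hM : 0 < M)
    (hKM : K ≤ M ^ γ)
    {N : ℕ} {x : ∀ j, Fin (N + 1) → X j} (hx : ∀ l ∈ L, ∀ j ∈ C l, UnitWeak 𝕜 (p l) (x j))
    (hx1 : ∀ j, (∀ l ∈ L, j ∉ C l) → UnitWeak 𝕜 1 (x j))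
    (w : (C l → Fin (N + 1)) → ℝ) (hw : ∀ v, 0 ≤ w v) (hw1 : ∑ v, w v ≤ 1) :
    ∑ u : C k → Fin (N + 1), (∑ v : C l → Fin (N + 1), w v ^ (((C l).card * invConj (p l)) * q) *
      ∑ i : ι → Fin (N + 1) with (C k).restrict i = u ∧ (C l).restrict i = v,
        (‖T fun j => x j (i j)‖ / M) ^ q) ^ (γ / q) ≤ 1 := by
  obtain ⟨g, hg, hg1, hwg⟩ := exists_marginals w hw hw1
  obtain ⟨x', hx'1, hx'2, hx'3⟩ := exists_weighted T (C l) (P := fun _ => p l) (fun _ _ => hp l)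
    (hx l hl) (fun j t => if hj : j ∈ C l then g ⟨j, hj⟩ t else 0)
    (fun j t => by split_ifs; exacts [hg _ _, le_rfl])
    (fun j hj => by simpa only [dif_pos hj] using hg1 ⟨j, hj⟩)
  have hb := h N x' (fun l' hl' j hj => by
      rw [Finset.mem_erase] at hl'
      rw [hx'2 j (Finset.disjoint_left.1 (hCdisj _ _ hl'.1) hj)]
      exact hx l' hl'.2 j hj) (fun j hj => by
      by_cases hjl : j ∈ C l
      · exact hx'1 j hjl
      · rw [hx'2 j hjl]
        refine hx1 j fun l' hl' => ?_
        rcases eq_or_ne l' l with rfl | hne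
        · exact hjl
        · exact hj l' (Finset.mem_erase.2 ⟨hne, hl'⟩))
  simp only [Finset.sum_const, nsmul_eq_mul] at hx'3
  have hpt : ∀ i : ι → Fin (N + 1), w ((C l).restrict i) ^ (((C l).card * invConj (p l)) * q)
      * (‖T fun j => x j (i j)‖ / M) ^ q ≤ (M ^ q)⁻¹ * ‖T fun j => x' j (i j)‖ ^ q := by
    intro i
    have h1 := hx'3 i (w ((C l).restrict i)) (hw _) (fun j hj => by
      rw [dif_pos hj]
      exact hwg ((C l).restrict i) ⟨j, hj⟩)
    have h2 := Real.rpow_le_rpow (mul_nonneg (Real.rpow_nonneg (hw _) _) (norm_nonneg _)) h1 hq.le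
    rw [Real.mul_rpow (Real.rpow_nonneg (hw _) _) (norm_nonneg _), ← Real.rpow_mul (hw _)] at h2
    rw [Real.div_rpow (norm_nonneg _) hM.le, mul_div_assoc', div_eq_inv_mul]
    exact mul_le_mul_of_nonneg_left h2 (by positivity)
  have hsum : ∀ u : C k → Fin (N + 1),
      (∑ v : C l → Fin (N + 1), w v ^ (((C l).card * invConj (p l)) * q) *
        ∑ i : ι → Fin (N + 1) with (C k).restrict i = u ∧ (C l).restrict i = v,
          (‖T fun j => x j (i j)‖ / M) ^ q)
      ≤ (M ^ q)⁻¹ * ∑ i : ι → Fin (N + 1) with (C k).restrict i = u,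
          ‖T fun j => x' j (i j)‖ ^ q := by
    intro u
    rw [Finset.mul_sum]
    refine le_trans (le_of_eq ?_) (Finset.sum_le_sum fun i _ => hpt i)
    rw [← Finset.sum_fiberwise (Finset.univ.filter fun i : ι → Fin (N + 1) => (C k).restrict i = u)
      (fun i => (C l).restrict i)]
    refine Finset.sum_congr rfl fun v _ => ?_
    rw [Finset.filter_filter, Finset.mul_sum]
    refine Finset.sum_congr rfl fun i hi => ?_
    rw [(Finset.mem_filter.1 hi).2.2]
  calc _ ≤ ∑ u : C k → Fin (N + 1), ((M ^ q)⁻¹ *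
          ∑ i : ι → Fin (N + 1) with (C k).restrict i = u,
            ‖T fun j => x' j (i j)‖ ^ q) ^ (γ / q) := by
        refine Finset.sum_le_sum fun u _ => Real.rpow_le_rpow ?_ (hsum u) (by positivity)
        exact Finset.sum_nonneg fun v _ => mul_nonneg (Real.rpow_nonneg (hw v) _)
          (Finset.sum_nonneg fun i _ => by positivity)
    _ = (M ^ γ)⁻¹ * ∑ u : C k → Fin (N + 1), (∑ i : ι → Fin (N + 1) with (C k).restrict i = u,
            ‖T fun j => x' j (i j)‖ ^ q) ^ (γ / q) := by
        rw [Finset.mul_sum]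
        refine Finset.sum_congr rfl fun u _ => ?_
        rw [Real.mul_rpow (by positivity) (by positivity), Real.inv_rpow (by positivity),
          ← Real.rpow_mul hM.le, mul_div_cancel₀ _ hq.ne']
    _ ≤ (M ^ γ)⁻¹ * M ^ γ := mul_le_mul_of_nonneg_left (hb.trans hKM) (by positivity)
    _ = 1 := inv_mul_cancel₀ (by positivity)

/-- The two-block inequality applies with `u`, `v` the multi-indices of the blocks `k`, `l`, the
remaining coordinates being summed in `ℓ^q` inside `c u v`. Division by a common `M` normalizes both
bounds to one. -/
theorem MixedBound.interpolate {T : MultilinearMap 𝕜 X Y} {n : ℕ} {C : Fin n → Finset ι}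
    {p : Fin n → ℝ} {q : ℝ} {k l : Fin n} {r r' γ : ℝ} {L : Finset (Fin n)} {K K' : ℝ}
    (hCdisj : ∀ k l, k ≠ l → Disjoint (C k) (C l)) (hp : ∀ k, 1 ≤ p k) (hq : 0 < q) (hr : 0 < r)
    (hr' : 0 < r') (hrq' : r' ≤ q) (hγ0 : 0 < γ)
    (hγ : 1 / γ = 1 / r - (C l).card * invConj (p l) *
      ((q / r - 1 + q * ((C k).card * invConj (p k))) /
        (q / r' - 1 + q * ((C l).card * invConj (p l)))))
    (hk : k ∈ L) (hl : l ∈ L)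
    (h : MixedBound T C p q k r (L.erase l) K) (h' : MixedBound T C p q l r' (L.erase k) K') :
    ∃ K'', MixedBound T C p q k γ L K'' := by
  obtain ⟨M₁, hM₁, hM₁'⟩ := exists_pos_le_rpow K hr
  obtain ⟨M₂, hM₂, hM₂'⟩ := exists_pos_le_rpow K' hr'
  set M := max M₁ M₂ with hMdef
  have hM : 0 < M := lt_max_of_lt_left hM₁
  refine ⟨M ^ γ, fun N x hx hx1 => ?_⟩
  have ht : ∀ k, 0 ≤ (C k).card * invConj (p k) := fun k =>
    mul_nonneg (Nat.cast_nonneg _) (invConj_nonneg (hp k))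
  have key := sum_rpow_sum_le_one_of_weighted
    (fun (u : C k → Fin (N + 1)) (v : C l → Fin (N + 1)) =>
      ∑ i : ι → Fin (N + 1) with (C k).restrict i = u ∧ (C l).restrict i = v,
        (‖T fun j => x j (i j)‖ / M) ^ q)
    (fun u v => Finset.sum_nonneg fun i _ => by positivity) hq hr hr' hrq' (ht k) (ht l) hγ0 hγ
    (fun w hw hw1 => h.sum_weighted_le_one hCdisj hp hq hr hl hM (hM₁' M (le_max_left _ _))
      hx hx1 w hw hw1)
    (fun w hw hw1 => by
      have := h'.sum_weighted_le_one hCdisj hp hq hr' hk hM (hM₂' M (le_max_right _ _))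
        hx hx1 w hw hw1
      simpa only [and_comm] using this)
  have e : ∀ u : C k → Fin (N + 1), (∑ v : C l → Fin (N + 1),
      ∑ i : ι → Fin (N + 1) with (C k).restrict i = u ∧ (C l).restrict i = v,
        (‖T fun j => x j (i j)‖ / M) ^ q)
      = (M ^ q)⁻¹ * ∑ i : ι → Fin (N + 1) with (C k).restrict i = u,
        ‖T fun j => x j (i j)‖ ^ q := by
    intro u
    rw [Finset.mul_sum, ← Finset.sum_fiberwise
      (Finset.univ.filter fun i : ι → Fin (N + 1) => (C k).restrict i = u)
      (fun i => (C l).restrict i)]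
    refine Finset.sum_congr rfl fun v _ => ?_
    rw [Finset.filter_filter]
    refine Finset.sum_congr rfl fun i hi => ?_
    rw [Real.div_rpow (norm_nonneg _) hM.le, div_eq_inv_mul]
  simp only [e] at key
  have e2 : ∀ u : C k → Fin (N + 1), ((M ^ q)⁻¹ * ∑ i : ι → Fin (N + 1) with
      (C k).restrict i = u, ‖T fun j => x j (i j)‖ ^ q) ^ (γ / q)
      = (M ^ γ)⁻¹ * (∑ i : ι → Fin (N + 1) with
      (C k).restrict i = u, ‖T fun j => x j (i j)‖ ^ q) ^ (γ / q) := by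
    intro u
    rw [Real.mul_rpow (by positivity) (by positivity), Real.inv_rpow (by positivity),
      ← Real.rpow_mul hM.le, mul_div_cancel₀ _ hq.ne']
  simp only [e2] at key
  rwa [← Finset.mul_sum, inv_mul_le_iff₀ (by positivity), mul_one] at key

end

/-! ### Arithmetic of the exponents -/

section
variable {n : ℕ} {q : ℝ} {c : Fin n → ℕ} {r p : Fin n → ℝ}

theorem invGamma_compl (k : Fin n) (L : Finset (Fin n)) :
    invGamma q c r p k Lᶜ = 1 / r k - (1 - q / r k - q * (c k * invConj (p k))) *
      ∑ j ∈ L.erase k, c j * invConj (p j) / (1 - q / r j - q * (c j * invConj (p j))) := by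
  have : Finset.univ \ (Lᶜ ∪ {k}) = L.erase k := by ext j; simp
  rw [invGamma, this, Finset.mul_sum]
  congr 1
  refine Finset.sum_congr rfl fun j _ => ?_
  rw [mul_assoc q, mul_assoc q]; ring

theorem invGamma_den_neg (hr : ∀ k, 1 ≤ r k ∧ r k < q) (hp : ∀ k, 1 ≤ p k) (k : Fin n) :
    1 - q / r k - q * (c k * invConj (p k)) < 0 := by
  have h1 : 0 < r k := by linarith [(hr k).1]
  have h2 : 1 < q / r k := (one_lt_div h1).2 (hr k).2
  have h3 : 0 ≤ q * (c k * invConj (p k)) := mul_nonneg (by linarith [(hr k).2])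
    (mul_nonneg (Nat.cast_nonneg _) (invConj_nonneg (hp k)))
  linarith

/-- All the factors `1 - q / r_j - q * c_j / p_j^*` are negative since `r_j < q`, so each term
subtracted from `1 / r_k` is nonnegative. This extends condition 2 to smaller sets of blocks. -/
theorem invGamma_compl_anti (hr : ∀ k, 1 ≤ r k ∧ r k < q) (hp : ∀ k, 1 ≤ p k) (k : Fin n)
    {L L' : Finset (Fin n)} (h : L' ⊆ L) :
    invGamma q c r p k Lᶜ ≤ invGamma q c r p k L'ᶜ := by
  rw [invGamma_compl, invGamma_compl]
  have h1 : ∑ j ∈ L.erase k, c j * invConj (p j) / (1 - q / r j - q * (c j * invConj (p j)))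
      ≤ ∑ j ∈ L'.erase k, c j * invConj (p j) / (1 - q / r j - q * (c j * invConj (p j))) := by
    rw [← neg_le_neg_iff, ← Finset.sum_neg_distrib, ← Finset.sum_neg_distrib]
    refine Finset.sum_le_sum_of_subset_of_nonneg (Finset.erase_subset_erase k h) fun j _ _ => ?_
    refine neg_nonneg.2 ?_
    exact div_nonpos_of_nonneg_of_nonpos
      (mul_nonneg (Nat.cast_nonneg _) (invConj_nonneg (hp j))) (invGamma_den_neg hr hp j).le
  have := mul_le_mul_of_nonpos_left h1 (invGamma_den_neg (c := c) hr hp k).le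
  linarith

/-- The recursion matching the interpolation formula. Numerator and denominator of the quotient
equal `-Ak` and `-Al` times the same factor `1 + q * s`, so the quotient is `Ak / Al`, independent
of `L`. -/
theorem invGamma_compl_eq (hr : ∀ k, 1 ≤ r k ∧ r k < q) (hp : ∀ k, 1 ≤ p k) {k l : Fin n}
    {L : Finset (Fin n)} (hl : l ∈ L) (hkl : k ≠ l)
    (hlq : 1 / q ≤ invGamma q c r p l (L.erase k)ᶜ) :
    invGamma q c r p k Lᶜ = invGamma q c r p k (L.erase l)ᶜ - c l * invConj (p l) *
      ((q * invGamma q c r p k (L.erase l)ᶜ - 1 + q * (c k * invConj (p k))) /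
        (q * invGamma q c r p l (L.erase k)ᶜ - 1 + q * (c l * invConj (p l)))) := by
  have hq : 0 < q := by linarith [(hr k).1, (hr k).2]
  have hAl := invGamma_den_neg (c := c) hr hp l
  have hsum : ∑ j ∈ L.erase k, c j * invConj (p j) / (1 - q / r j - q * (c j * invConj (p j)))
      = c l * invConj (p l) / (1 - q / r l - q * (c l * invConj (p l))) +
        ∑ j ∈ (L.erase l).erase k,
          c j * invConj (p j) / (1 - q / r j - q * (c j * invConj (p j))) := by
    rw [Finset.erase_right_comm, Finset.add_sum_erase _ (fun j => c j * invConj (p j) /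
      (1 - q / r j - q * (c j * invConj (p j)))) (Finset.mem_erase.2 ⟨hkl.symm, hl⟩)]
  have hek := invGamma_compl (q := q) (c := c) (r := r) (p := p) k (L.erase l)
  have hel := invGamma_compl (q := q) (c := c) (r := r) (p := p) l (L.erase k)
  rw [Finset.erase_right_comm] at hel
  rw [invGamma_compl, hsum]
  set s := ∑ j ∈ (L.erase l).erase k,
    c j * invConj (p j) / (1 - q / r j - q * (c j * invConj (p j)))
  set tl : ℝ := c l * invConj (p l) with htl
  set tk : ℝ := c k * invConj (p k) with htk
  have htl0 : 0 ≤ tl := mul_nonneg (Nat.cast_nonneg _) (invConj_nonneg (hp l))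
  set G := invGamma q c r p k (L.erase l)ᶜ
  set G' := invGamma q c r p l (L.erase k)ᶜ
  set Ak := 1 - q / r k - q * tk with hAk
  set Al := 1 - q / r l - q * tl with hAldef
  have e1 : q * G - 1 + q * tk = -Ak * (1 + q * s) := by
    rw [hek, hAk]; ring
  have e2 : q * G' - 1 + q * tl = -Al * (1 + q * s) := by
    rw [hel, hAldef]; ring
  rw [e1, e2, show (1 / r k - Ak * (tl / Al + s)) = G - tl * (Ak / Al) by rw [hek]; ring]
  congr 1
  -- If the common factor vanishes, then `hlq` forces `tl = 0`, and both quotients are multiplied by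
  -- zero.
  by_cases hs : 1 + q * s = 0
  · have : tl = 0 := by
      rw [hs, mul_zero] at e2
      have h3 : 1 ≤ q * G' := by
        rw [div_le_iff₀ hq] at hlq; linarith
      have h4 : q * tl = 0 := le_antisymm (by linarith) (by positivity)
      exact (mul_eq_zero.1 h4).resolve_left hq.ne'
    simp [this]
  · rw [mul_div_mul_right _ _ hs, neg_div_neg_eq]

end

/-! ### Induction on the number of blocks -/

section
variable {𝕜 : Type*} [RCLike 𝕜] {ι : Type*} [Fintype ι] [DecidableEq ι] {X : ι → Type*}
  [∀ j, NormedAddCommGroup (X j)] [∀ j, NormedSpace 𝕜 (X j)]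
  {Y : Type*} [NormedAddCommGroup Y] [NormedSpace 𝕜 Y]

theorem exists_mixedBound_of_subset {T : MultilinearMap 𝕜 X Y} {n : ℕ} {C : Fin n → Finset ι}
    (hCdisj : ∀ k l, k ≠ l → Disjoint (C k) (C l)) {q : ℝ} {r p : Fin n → ℝ}
    (hr : ∀ k, 1 ≤ r k ∧ r k < q) (hp : ∀ k, 1 ≤ p k) {J : Finset (Fin n)}
    (h2 : ∀ k l, k ∉ J → l ∉ J → k ≠ l →
      1 / q ≤ invGamma q (fun j => (C j).card) r p k (J ∪ {l}))
    (hbase : ∀ k, ∃ K, MixedBound T C p q k (r k) {k} K) :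
    ∀ (d : ℕ) (L : Finset (Fin n)), L.card = d + 1 → L ⊆ Jᶜ → ∀ k ∈ L,
      0 < invGamma q (fun j => (C j).card) r p k Lᶜ →
      ∃ K, MixedBound T C p q k (1 / invGamma q (fun j => (C j).card) r p k Lᶜ) L K := by
  intro d
  induction d with
  | zero =>
    intro L hL _ k hk _
    obtain ⟨k', rfl⟩ := Finset.card_eq_one.1 hL
    obtain rfl := Finset.mem_singleton.1 hk
    rw [invGamma_compl]
    simpa using hbase k
  | succ d ih =>
    intro L hL hLJ k hk hpos
    have hq : 0 < q := by linarith [(hr k).1, (hr k).2]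
    obtain ⟨l, hl, hlk⟩ := Finset.exists_mem_ne (s := L) (by omega) k
    have hge : ∀ k l, k ∈ L → l ∈ L → k ≠ l →
        1 / q ≤ invGamma q (fun j => (C j).card) r p k (L.erase l)ᶜ := by
      intro k l hk hl hkl
      -- `L \ {l}` is contained in the complement of `J ∪ {l}`, so monotonicity applies.
      refine (h2 k l (Finset.mem_compl.1 (hLJ hk)) (Finset.mem_compl.1 (hLJ hl)) hkl).trans ?_
      rw [← compl_compl (J ∪ {l})]
      refine invGamma_compl_anti hr hp k fun j hj => ?_
      rw [Finset.mem_erase] at hj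
      have := hLJ hj.2
      simp only [Finset.mem_compl, Finset.mem_union, Finset.mem_singleton, not_or] at this ⊢
      exact ⟨this, hj.1⟩
    have hq1 : 0 < 1 / q := by positivity
    have g1 := hge k l hk hl hlk.symm
    have g2 := hge l k hl hk hlk
    obtain ⟨K, hK⟩ := ih (L.erase l) (by rw [Finset.card_erase_of_mem hl, hL]; omega)
      ((Finset.erase_subset _ _).trans hLJ) k (Finset.mem_erase.2 ⟨hlk.symm, hk⟩) (by linarith)
    obtain ⟨K', hK'⟩ := ih (L.erase k) (by rw [Finset.card_erase_of_mem hk, hL]; omega)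
      ((Finset.erase_subset _ _).trans hLJ) l (Finset.mem_erase.2 ⟨hlk, hl⟩) (by linarith)
    refine hK.interpolate hCdisj hp hq (by rw [one_div_pos]; linarith)
      (by rw [one_div_pos]; linarith) ?_ (by rwa [one_div_pos]) ?_ hk hl hK'
    · rw [one_div_le (by linarith) hq]; exact g2
    · simp only [one_div_one_div]
      rw [div_div_eq_mul_div, div_one, div_div_eq_mul_div, div_one]
      exact invGamma_compl_eq hr hp hl hlk.symm g2

end

/-! ### Passage between sequences and finite families -/

section
variable {𝕜 : Type*} [RCLike 𝕜] {ι : Type*} [Fintype ι] [DecidableEq ι] {X : ι → Type*}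
  [∀ j, NormedAddCommGroup (X j)] [∀ j, NormedSpace 𝕜 (X j)]
  {Y : Type*} [NormedAddCommGroup Y] [NormedSpace 𝕜 Y]

theorem enorm_rpow_eq_ofReal {E : Type*} [NormedAddCommGroup E] (v : E) {r : ℝ} (hr : 0 ≤ r) :
    ‖v‖ₑ ^ r = ENNReal.ofReal (‖v‖ ^ r) := by
  rw [← ofReal_norm, ENNReal.ofReal_rpow_of_nonneg (norm_nonneg _) hr]

theorem IsMultipleSumming.exists_sum_le {T : MultilinearMap 𝕜 X Y} {r : ℝ} {p : ι → ℝ}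
    (h : IsMultipleSumming T r p) (hr : 1 ≤ r) (hp : ∀ j, 1 ≤ p j) :
    ∃ K : ℝ, ∀ (N : ℕ) (x : ∀ j, Fin N → X j), (∀ j, UnitWeak 𝕜 (p j) (x j)) →
      ∑ i : ι → Fin N, ‖T fun j => x j (i j)‖ ^ r ≤ K := by
  obtain ⟨K, _, hK⟩ := h
  have hr0 : 0 < r := by linarith
  refine ⟨(K : ℝ) ^ r, fun N x hx => ?_⟩
  let x' : ∀ j, ℕ → X j := fun j t => if h : t < N then x j ⟨t, h⟩ else 0
  have hw : ∀ j, weakNorm 𝕜 (p j) (x' j) ≤ 1 := by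
    intro j
    have hpj : 0 < p j := by linarith [hp j]
    refine iSup₂_le fun φ hφ => ?_
    have e : ∑' t, ‖φ (x' j t)‖ₑ ^ p j = ENNReal.ofReal (∑ t, ‖φ (x j t)‖ ^ p j) := by
      rw [tsum_eq_sum (s := Finset.range N), Finset.sum_range,
        ENNReal.ofReal_sum_of_nonneg fun t _ => by positivity]
      · refine Finset.sum_congr rfl fun t _ => ?_
        rw [enorm_rpow_eq_ofReal _ hpj.le]
        simp [x']
      · intro t ht
        have : ¬ t < N := by simpa using ht
        simp [x', this, hpj]
    rw [e]
    refine ENNReal.rpow_le_one ?_ (by positivity)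
    exact ENNReal.ofReal_le_one.2 (hx j φ hφ)
  have h1 : (∑' i : ι → ℕ, ‖T fun j => x' j (i j)‖ₑ ^ r) ^ (1 / r) ≤ K :=
    (hK x').trans (mul_le_of_le_one_right' (Finset.prod_le_one' fun j _ => hw j))
  have h2 : ∑' i : ι → ℕ, ‖T fun j => x' j (i j)‖ₑ ^ r ≤ (K : ℝ≥0∞) ^ r := by
    rwa [one_div, ENNReal.rpow_inv_le_iff hr0] at h1
  have hinj : Function.Injective fun (i : ι → Fin N) (j : ι) => (i j : ℕ) := by
    intro i i' h
    ext j
    exact congrFun h j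
  have h3 := (ENNReal.tsum_comp_le_tsum_of_injective hinj
    (fun i : ι → ℕ => ‖T fun j => x' j (i j)‖ₑ ^ r)).trans h2
  have h4 : ENNReal.ofReal (∑ i : ι → Fin N, ‖T fun j => x j (i j)‖ ^ r)
      ≤ ENNReal.ofReal ((K : ℝ) ^ r) := by
    rw [tsum_fintype] at h3
    rw [ENNReal.ofReal_sum_of_nonneg fun i _ => by positivity,
      ← ENNReal.ofReal_rpow_of_nonneg K.coe_nonneg hr0.le, ENNReal.ofReal_coe_nnreal]
    refine le_trans (le_of_eq ?_) h3
    refine Finset.sum_congr rfl fun i _ => ?_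
    rw [enorm_rpow_eq_ofReal _ hr0.le]
    simp [x']
  exact (ENNReal.ofReal_le_ofReal_iff (by positivity)).1 h4

theorem weakNorm_ne_zero {E : Type*} [NormedAddCommGroup E] [NormedSpace 𝕜 E] {p : ℝ} (hp : 1 ≤ p)
    {x : ℕ → E} {t : ℕ} (h : x t ≠ 0) : weakNorm 𝕜 p x ≠ 0 := by
  have hp0 : 0 < p := by linarith
  obtain ⟨φ, hφ, hx⟩ := exists_dual_vector'' 𝕜 (x t)
  intro h0
  have h1 : (∑' i, ‖φ (x i)‖ₑ ^ p) ^ (1 / p) = 0 :=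
    le_antisymm (h0 ▸ le_iSup₂ (f := fun (φ : StrongDual 𝕜 E) (_ : ‖φ‖ ≤ 1) =>
      (∑' i, ‖φ (x i)‖ₑ ^ p) ^ (1 / p)) φ hφ) (zero_le)
  rw [ENNReal.rpow_eq_zero_iff_of_pos (by positivity), ENNReal.tsum_eq_zero] at h1
  have h2 := h1 t
  rw [ENNReal.rpow_eq_zero_iff_of_pos hp0, enorm_eq_zero, hx] at h2
  exact h (by simpa using h2)

theorem unitWeak_inv_smul {E : Type*} [NormedAddCommGroup E] [NormedSpace 𝕜 E] {p : ℝ}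
    (hp : 1 ≤ p) {x : ℕ → E} (h0 : weakNorm 𝕜 p x ≠ 0) (h1 : weakNorm 𝕜 p x ≠ ∞) (N : ℕ) :
    UnitWeak 𝕜 p fun t : Fin N => (((weakNorm 𝕜 p x).toReal⁻¹ : ℝ) : 𝕜) • x t := by
  intro φ hφ
  have hp0 : 0 < p := by linarith
  set w := (weakNorm 𝕜 p x).toReal with hw
  have hw0 : 0 < w := ENNReal.toReal_pos h0 h1
  have h2 : (∑' i, ‖φ (x i)‖ₑ ^ p) ^ (1 / p) ≤ weakNorm 𝕜 p x :=
    le_iSup₂ (f := fun (φ : StrongDual 𝕜 E) (_ : ‖φ‖ ≤ 1) =>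
      (∑' i, ‖φ (x i)‖ₑ ^ p) ^ (1 / p)) φ hφ
  rw [one_div, ENNReal.rpow_inv_le_iff hp0] at h2
  have h3 : ENNReal.ofReal (∑ t : Fin N, ‖φ (x t)‖ ^ p) ≤ ENNReal.ofReal (w ^ p) := by
    rw [ENNReal.ofReal_sum_of_nonneg fun i _ => by positivity,
      ← ENNReal.ofReal_rpow_of_nonneg hw0.le hp0.le, hw, ENNReal.ofReal_toReal h1]
    refine le_trans (le_of_eq ?_) ((ENNReal.sum_le_tsum (Finset.range N)).trans h2)
    rw [Finset.sum_range]
    exact Finset.sum_congr rfl fun t _ => (enorm_rpow_eq_ofReal _ hp0.le).symm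
  rw [ENNReal.ofReal_le_ofReal_iff (by positivity)] at h3
  have e : ∀ t : Fin N, ‖φ (((w⁻¹ : ℝ) : 𝕜) • x t)‖ ^ p = (w ^ p)⁻¹ * ‖φ (x t)‖ ^ p := by
    intro t
    rw [map_smul, norm_smul, RCLike.norm_ofReal, abs_of_pos (inv_pos.2 hw0),
      Real.mul_rpow (by positivity) (norm_nonneg _), Real.inv_rpow hw0.le]
  simp only [e]
  rwa [← Finset.mul_sum, inv_mul_le_iff₀ (by positivity), mul_one]

/-- By homogeneity each sequence is divided by its weak norm. Zero sequences are treated first, so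
that no product `0 * ∞` arises when some weak norm is infinite. -/
theorem IsMultipleSumming.of_sum_le {T : MultilinearMap 𝕜 X Y} {s : ℝ} {p : ι → ℝ} (hs : 0 < s)
    (hp : ∀ j, 1 ≤ p j) {K : ℝ}
    (hK : ∀ (N : ℕ) (x : ∀ j, Fin (N + 1) → X j), (∀ j, UnitWeak 𝕜 (p j) (x j)) →
      ∑ i : ι → Fin (N + 1), ‖T fun j => x j (i j)‖ ^ s ≤ K) :
    IsMultipleSumming T s p := by
  obtain ⟨M, hM, hM'⟩ := exists_pos_le_rpow K hs
  refine ⟨M.toNNReal, by simpa using hM, fun x => ?_⟩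
  by_cases hx0 : ∃ j, ∀ t, x j t = 0
  · obtain ⟨j, hj⟩ := hx0
    have : ∀ i : ι → ℕ, ‖T fun j => x j (i j)‖ₑ ^ s = 0 := fun i => by
      rw [T.map_coord_zero j (hj _)]; simp [hs]
    simp [this, hs]
  push Not at hx0
  have hw0 : ∀ j, weakNorm 𝕜 (p j) (x j) ≠ 0 := fun j => weakNorm_ne_zero (hp j) (hx0 j).choose_spec
  by_cases hx1 : ∃ j, weakNorm 𝕜 (p j) (x j) = ∞
  · obtain ⟨j, hj⟩ := hx1
    have : ∏ j, weakNorm 𝕜 (p j) (x j) = ∞ := by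
      rw [← Finset.mul_prod_erase _ _ (Finset.mem_univ j), hj]
      exact ENNReal.top_mul (Finset.prod_ne_zero_iff.2 fun j _ => hw0 j)
    rw [this, ENNReal.mul_top (by simpa using hM)]
    exact le_top
  push Not at hx1
  set w : ι → ℝ := fun j => (weakNorm 𝕜 (p j) (x j)).toReal with hw
  have hwpos : ∀ j, 0 < w j := fun j => ENNReal.toReal_pos (hw0 j) (hx1 j)
  have hprod : ∏ j, weakNorm 𝕜 (p j) (x j) = ENNReal.ofReal (∏ j, w j) := by
    rw [ENNReal.ofReal_prod_of_nonneg fun j _ => (hwpos j).le]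
    exact Finset.prod_congr rfl fun j _ => (ENNReal.ofReal_toReal (hx1 j)).symm
  have hW : 0 < ∏ j, w j := Finset.prod_pos fun j _ => hwpos j
  have hT : ∀ i : ι → ℕ, ‖T fun j => x j (i j)‖
      = (∏ j, w j) * ‖T fun j => (((w j)⁻¹ : ℝ) : 𝕜) • x j (i j)‖ := by
    intro i
    rw [T.map_smul_univ (fun j => (((w j)⁻¹ : ℝ) : 𝕜)) fun j => x j (i j), norm_smul, norm_prod,
      ← mul_assoc]
    have : ∏ j, ‖(((w j)⁻¹ : ℝ) : 𝕜)‖ = (∏ j, w j)⁻¹ := by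
      rw [← Finset.prod_inv_distrib]
      refine Finset.prod_congr rfl fun j _ => ?_
      rw [RCLike.norm_ofReal, abs_of_pos (inv_pos.2 (hwpos j))]
    rw [this, mul_inv_cancel₀ hW.ne', one_mul]
  rw [hprod, ENNReal.ofNNReal_toNNReal, ← ENNReal.ofReal_mul hM.le, one_div,
    ENNReal.rpow_inv_le_iff hs, ENNReal.tsum_eq_iSup_sum]
  refine iSup_le fun F => ?_
  obtain ⟨N, hN⟩ : ∃ N : ℕ, ∀ i ∈ F, ∀ j, i j < N + 1 := by
    refine ⟨∑ i ∈ F, ∑ j, i j, fun i hi j => Nat.lt_succ_of_le ?_⟩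
    exact (Finset.single_le_sum (f := fun j => i j) (fun _ _ => Nat.zero_le _)
      (Finset.mem_univ j)).trans
      (Finset.single_le_sum (f := fun i : ι → ℕ => ∑ j, i j) (fun _ _ => Nat.zero_le _) hi)
  have hb := hK N (fun j t => (((w j)⁻¹ : ℝ) : 𝕜) • x j t)
    (fun j => unitWeak_inv_smul (hp j) (hw0 j) (hx1 j) (N + 1))
  have hreal : ∑ i ∈ F, ‖T fun j => x j (i j)‖ ^ s ≤ (M * ∏ j, w j) ^ s := by
    have hsub : ∑ i ∈ F, ‖T fun j => (((w j)⁻¹ : ℝ) : 𝕜) • x j (i j)‖ ^ s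
        ≤ ∑ i : ι → Fin (N + 1), ‖T fun j => (((w j)⁻¹ : ℝ) : 𝕜) • x j (i j)‖ ^ s := by
      have hinj : Function.Injective fun (i : ι → Fin (N + 1)) (j : ι) => (i j : ℕ) := by
        intro i i' h
        ext j
        exact congrFun h j
      rw [← Finset.sum_image (s := Finset.univ) (g := fun (i : ι → Fin (N + 1)) (j : ι) => (i j : ℕ))
        (f := fun i : ι → ℕ => ‖T fun j => (((w j)⁻¹ : ℝ) : 𝕜) • x j (i j)‖ ^ s) hinj.injOn]
      refine Finset.sum_le_sum_of_subset_of_nonneg (fun i hi => ?_) fun i _ _ => by positivity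
      exact Finset.mem_image.2 ⟨fun j => ⟨i j, hN i hi j⟩, Finset.mem_univ _, rfl⟩
    have hle := hsub.trans (hb.trans (hM' M le_rfl))
    simp only [hT, Real.mul_rpow hW.le (norm_nonneg _)]
    rw [← Finset.mul_sum, mul_comm M, Real.mul_rpow hW.le hM.le]
    exact mul_le_mul_of_nonneg_left hle (by positivity)
  rw [ENNReal.ofReal_rpow_of_nonneg (by positivity) hs.le]
  refine le_trans (le_of_eq ?_) (ENNReal.ofReal_le_ofReal hreal)
  rw [ENNReal.ofReal_sum_of_nonneg fun i _ => by positivity]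
  exact Finset.sum_congr rfl fun i _ => enorm_rpow_eq_ofReal _ hs.le

theorem IsSummingInCoords.exists_sum_le {T : MultilinearMap 𝕜 X Y} {C : Finset ι} {r p : ℝ}
    (h : IsSummingInCoords T C r p) (hr : 1 ≤ r) (hp : 1 ≤ p) (z : ∀ j, X j) :
    ∃ K : ℝ, ∀ (N : ℕ) (x : ∀ j, Fin N → X j),
      (∀ j ∈ C, UnitWeak 𝕜 p (x j)) → ∑ u : C → Fin N, ‖T (glue C x z u)‖ ^ r ≤ K := by
  obtain ⟨K, hK⟩ := (h fun j => z j).exists_sum_le hr fun _ => hp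
  exact ⟨K, fun N x hx => hK N (fun j t => x j t) fun j => hx j j.2⟩

/-- A multilinear map which is summing in the coordinates of `C` is separately continuous in
these coordinates. -/
theorem IsSummingInCoords.continuous_update {T : MultilinearMap 𝕜 X Y} {C : Finset ι} {r p : ℝ}
    (h : IsSummingInCoords T C r p) (hr : 1 ≤ r) (hp : 1 ≤ p) {a : ι} (ha : a ∈ C)
    (z : ∀ j, X j) : Continuous fun v => T (Function.update z a v) := by
  have hr0 : 0 < r := by linarith
  -- Rescaling puts the fixed vectors in the unit ball, so that one-term families (`N = 1`) have
  -- weak norm at most one and the summing estimate bounds `T` itself.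
  let d : ι → ℝ := fun j => if j = a then 1 else ‖z j‖ + 1
  have hd : ∀ j, 0 < d j := fun j => by simp only [d]; split_ifs <;> positivity
  let z' : ∀ j, X j := fun j => (((d j)⁻¹ : ℝ) : 𝕜) • z j
  have hz' : ∀ j, j ≠ a → ‖z' j‖ ≤ 1 := by
    intro j hj
    simp only [z', norm_smul, RCLike.norm_ofReal, abs_of_pos (inv_pos.2 (hd j))]
    rw [inv_mul_le_iff₀ (hd j)]
    simp [d, hj]
  have hzz' : ∀ v, T (Function.update z a v)
      = (∏ j, (d j : 𝕜)) • T (Function.update z' a v) := by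
    intro v
    rw [← T.map_smul_univ]
    congr 1
    ext j
    rcases eq_or_ne j a with rfl | hj
    · simp [d]
    · simp only [Function.update_of_ne hj, z', smul_smul]
      rw [← RCLike.ofReal_mul, mul_inv_cancel₀ (hd j).ne']; simp
  obtain ⟨K, hK⟩ := h.exists_sum_le hr hp z'
  obtain ⟨M, hM, hM'⟩ := exists_pos_le_rpow K hr0
  have hunit : ∀ v : X a, ‖v‖ ≤ 1 → ‖T (Function.update z' a v)‖ ≤ M := by
    intro v hv
    have hx : ∀ j, ‖Function.update z' a v j‖ ≤ 1 := by
      intro j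
      rcases eq_or_ne j a with rfl | hj
      · simpa using hv
      · rw [Function.update_of_ne hj]; exact hz' j hj
    have h1 := (hK 1 (fun j _ => Function.update z' a v j) fun j _ φ hφ => by
      rw [Fin.sum_univ_one]
      refine Real.rpow_le_one (norm_nonneg _) ?_ (by linarith)
      exact (φ.le_opNorm _).trans (mul_le_one₀ hφ (norm_nonneg _) (hx j))).trans (hM' M le_rfl)
    rw [Fintype.sum_unique] at h1
    have e : glue C (fun j _ => Function.update z' a v j) z' (default : C → Fin 1)
        = Function.update z' a v := by
      ext j
      by_cases hj : j ∈ C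
      · simp [glue, hj]
      · rw [glue, dif_neg hj, Function.update_of_ne (by rintro rfl; exact hj ha)]
    rw [e] at h1
    exact (Real.rpow_le_rpow_iff (norm_nonneg _) hM.le hr0).1 h1
  have hcont : Continuous (T.toLinearMap z' a) := by
    refine AddMonoidHomClass.continuous_of_bound (T.toLinearMap z' a) M fun v => ?_
    rcases eq_or_ne v 0 with rfl | hv
    · simp
    have hv0 : 0 < ‖v‖ := norm_pos_iff.2 hv
    have h1 := hunit (((‖v‖⁻¹ : ℝ) : 𝕜) • v) (by
      rw [norm_smul, RCLike.norm_ofReal, abs_of_pos (inv_pos.2 hv0), inv_mul_cancel₀ hv0.ne'])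
    rw [T.map_update_smul, norm_smul, RCLike.norm_ofReal, abs_of_pos (inv_pos.2 hv0),
      inv_mul_le_iff₀ hv0] at h1
    rw [mul_comm]
    exact h1
  simp only [hzz']
  exact hcont.const_smul _

/-! ### The case of one block and the conclusion -/

theorem exists_mixedBound_singleton [∀ j, CompleteSpace (X j)] {T : MultilinearMap 𝕜 X Y} {n : ℕ}
    {C : Fin n → Finset ι} (hCcover : ∀ j, ∃ k, j ∈ C k) {q : ℝ} (hY : HasCotype Y q)
    {r p : Fin n → ℝ} (hr : ∀ k, 1 ≤ r k ∧ r k < q) (hp : ∀ k, 1 ≤ p k)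
    (hT : ∀ k, IsSummingInCoords T (C k) (r k) (p k)) (k : Fin n) :
    ∃ K, MixedBound T C p q k (r k) {k} K := by
  let _ : NormedSpace ℝ Y := NormedSpace.restrictScalars ℝ 𝕜 Y
  obtain ⟨c, hc, hcot⟩ := hY.exists_sum_rpow_le
  obtain ⟨K, hK⟩ := exists_uniform_sum_le T (fun z j => by
      obtain ⟨l, hl⟩ := hCcover j
      exact (hT l).continuous_update (hr l).1 (hp l) hl z) (C k) (hr k).1 (p k)
    ((hT k).exists_sum_le (hr k).1 (hp k)) (Finset.univ \ C k) Finset.sdiff_disjoint 0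
  obtain ⟨K', hK'⟩ := exists_mixed_sum_le T (C k) (hr k).1 (hr k).2.le hc hcot (p := p k) (K := K)
    (fun z hz N x hx => by
      have hz0 : ∀ z' : ∀ j, X j, (∀ j ∉ C k, z' j = z j) → ∀ u, glue (C k) x z u
          = glue (C k) x z' u := by
        intro z' hz' u
        ext j
        by_cases hj : j ∈ C k
        · simp [glue, hj]
        · simp [glue, hj, hz' j hj]
      -- The coordinates of `z` in `C k` are replaced in `glue`, so they may be set to the base
      -- point `0` of the uniform estimate.
      let z' : ∀ j, X j := fun j => if j ∈ C k then 0 else z j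
      simp only [hz0 z' fun j hj => by simp [z', hj]]
      refine hK z' (fun j hj => ?_) (fun j hj => ?_) N x hx
      · have hj : j ∉ C k := by simpa using hj
        simpa [z', hj] using hz j hj
      · have hj : j ∈ C k := by simpa using hj
        simp [z', hj])
  refine ⟨K', fun N x hx hx1 => hK' N x (hx k (Finset.mem_singleton_self k)) fun j hj => ?_⟩
  exact hx1 j fun l hl => by rwa [Finset.mem_singleton.1 hl]

/-- The weak `ℓ^1` norms in the blocks outside `L` can be replaced by weak `ℓ^p` norms, at the cost
of a larger exponent. -/
theorem MixedBound.exists_sum_le {T : MultilinearMap 𝕜 X Y} {n : ℕ} {C : Fin n → Finset ι}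
    {p : Fin n → ℝ} {q : ℝ} {k : Fin n} {γ : ℝ} {J : Finset (Fin n)} {K : ℝ}
    (hCdisj : ∀ k l, k ≠ l → Disjoint (C k) (C l)) (hCcover : ∀ j, ∃ k, j ∈ C k)
    (hp : ∀ k, 1 ≤ p k) {qs : ι → ℝ} (hqs : ∀ k, ∀ j ∈ C k, qs j = p k) (hq : 0 < q)
    (hqγ : q ≤ γ) {s : ℝ} (hs0 : 0 < s)
    (hs : 1 / s = 1 / γ - ∑ j ∈ J, (C j).card * invConj (p j))
    (h : MixedBound T C p q k γ Jᶜ K) :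
    ∃ K', ∀ (N : ℕ) (x : ∀ j, Fin (N + 1) → X j), (∀ j, UnitWeak 𝕜 (qs j) (x j)) →
      ∑ i : ι → Fin (N + 1), ‖T fun j => x j (i j)‖ ^ s ≤ K' := by
  have hγ : 0 < γ := by linarith
  obtain ⟨M, hM, hM'⟩ := exists_pos_le_rpow K hγ
  refine ⟨M ^ s, fun N x hx => ?_⟩
  set D := J.biUnion C with hD
  have hqs1 : ∀ j, 1 ≤ qs j := fun j => by
    obtain ⟨l, hl⟩ := hCcover j
    rw [hqs l j hl]; exact hp l
  have hτ : ∑ j ∈ D, invConj (qs j) = ∑ j ∈ J, (C j).card * invConj (p j) := by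
    rw [hD, Finset.sum_biUnion fun k _ l _ hkl => hCdisj k l hkl]
    refine Finset.sum_congr rfl fun l _ => ?_
    rw [Finset.sum_congr rfl fun j hj => by rw [hqs l j hj], Finset.sum_const, nsmul_eq_mul]
  rw [← hτ] at hs
  have key := sum_rpow_le_one_of_weighted
    (fun i : ι → Fin (N + 1) => ‖T fun j => x j (i j)‖ / M) (fun i => by positivity) hγ hs0 hs
    (fun w hw hw1 => by
      obtain ⟨g, hg, hg1, hwg⟩ := exists_marginals w hw hw1
      obtain ⟨x', hx'1, hx'2, hx'3⟩ := exists_weighted T D (fun j _ => hqs1 j)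
        (fun j _ => hx j) g hg (fun j _ => hg1 j)
      have hb := (h N x' (fun l hl j hj => by
          have hjD : j ∉ D := by
            rw [hD, Finset.mem_biUnion]
            rintro ⟨l', hl', hj'⟩
            have hne : l ≠ l' := by rintro rfl; exact Finset.mem_compl.1 hl hl'
            exact Finset.disjoint_left.1 (hCdisj _ _ hne) hj hj'
          rw [hx'2 j hjD, ← hqs l j hj]; exact hx j) (fun j hj => by
          obtain ⟨l, hl⟩ := hCcover j
          refine hx'1 j (Finset.mem_biUnion.2 ⟨l, ?_, hl⟩)
          by_contra hlJ
          exact hj l (Finset.mem_compl.2 hlJ) hl)).trans (hM' M le_rfl)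
      have hsum : ∑ i : ι → Fin (N + 1), ‖T fun j => x' j (i j)‖ ^ γ ≤ M ^ γ := by
        refine le_trans ?_ hb
        -- Grouping by the indices of block `k`, the inner `ℓ^γ` sums are at most the `ℓ^q` sums
        -- because `q ≤ γ`.
        rw [← Finset.sum_fiberwise Finset.univ (fun i : ι → Fin (N + 1) => (C k).restrict i)]
        refine Finset.sum_le_sum fun u _ => ?_
        refine le_trans (le_of_eq ?_) (Finset.sum_rpow_le_rpow_sum _
          (fun i : ι → Fin (N + 1) => ‖T fun j => x' j (i j)‖ ^ q) (fun i => by positivity)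
          ((one_le_div hq).2 hqγ))
        refine Finset.sum_congr rfl fun i _ => ?_
        rw [← Real.rpow_mul (norm_nonneg _), mul_div_cancel₀ _ hq.ne']
      calc _ ≤ ∑ i : ι → Fin (N + 1), (M ^ γ)⁻¹ * ‖T fun j => x' j (i j)‖ ^ γ := by
            refine Finset.sum_le_sum fun i _ => ?_
            rw [mul_div_assoc', Real.div_rpow (mul_nonneg (Real.rpow_nonneg (hw i) _)
              (norm_nonneg _)) hM.le, div_eq_inv_mul]
            refine mul_le_mul_of_nonneg_left (Real.rpow_le_rpow (mul_nonneg
              (Real.rpow_nonneg (hw i) _) (norm_nonneg _)) ?_ hγ.le) (by positivity)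
            exact hx'3 i (w i) (hw i) fun j _ => hwg i j
        _ ≤ (M ^ γ)⁻¹ * M ^ γ := by
            rw [← Finset.mul_sum]
            exact mul_le_mul_of_nonneg_left hsum (by positivity)
        _ = 1 := inv_mul_cancel₀ (by positivity))
  simp only [Real.div_rpow (norm_nonneg _) hM.le] at key
  rwa [← Finset.sum_div, div_le_one (by positivity)] at key

end

theorem theorem2p2 {𝕜 : Type*} [RCLike 𝕜] {m n : ℕ} (hm : 2 ≤ m) (hn : 2 ≤ n)
    {X : Fin m → Type*} [∀ j, NormedAddCommGroup (X j)] [∀ j, NormedSpace 𝕜 (X j)]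
    [∀ j, CompleteSpace (X j)]
    {Y : Type*} [NormedAddCommGroup Y] [NormedSpace 𝕜 Y] [CompleteSpace Y]
    -- the blocks `C_1, …, C_n`, a partition of the coordinates into non-empty sets
    (C : Fin n → Finset (Fin m)) (hCne : ∀ k, (C k).Nonempty)
    (hCdisj : ∀ k l, k ≠ l → Disjoint (C k) (C l)) (hCcover : ∀ j, ∃ k, j ∈ C k)
    (q : ℝ) (hY : HasCotype Y q)
    (r p : Fin n → ℝ) (hr : ∀ k, 1 ≤ r k ∧ r k < q) (hp : ∀ k, 1 ≤ p k)
    (qs : Fin m → ℝ) (hqs : ∀ k, ∀ j ∈ C k, qs j = p k)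
    (J : Finset (Fin n)) (k₀ : Fin n) (hk₀ : k₀ ∉ J)
    (h1 : q ≤ gammaExp q (fun j => (C j).card) r p k₀ J)
    (h2 : ∀ k l, k ∉ J → l ∉ J → k ≠ l →
      0 < gammaExp q (fun j => (C j).card) r p k (J ∪ {l}) ∧
        gammaExp q (fun j => (C j).card) r p k (J ∪ {l}) ≤ q)
    (h3 : ∀ k l, k ∉ J → l ∉ J → k ≠ l →
      (C l).card * gammaExp q (fun j => (C j).card) r p k (J ∪ {l}) * invConj (p l) ≤ 1)
    (s : ℝ)
    (hs : 1 / s = 1 / gammaExp q (fun j => (C j).card) r p k₀ J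
      - ∑ j ∈ J, (C j).card * invConj (p j))
    (hs0 : 0 < s)
    (T : MultilinearMap 𝕜 X Y)
    (hT : ∀ k, IsSummingInCoords T (C k) (r k) (p k)) :
    IsMultipleSumming T s qs := by
  obtain ⟨hq2, -⟩ := id hY
  have hq : 0 < q := by linarith
  -- `γ ≥ q > 0` excludes the default value `1 / 0 = 0`.
  have hG : 0 < invGamma q (fun j => (C j).card) r p k₀ J := by
    have : 0 < gammaExp q (fun j => (C j).card) r p k₀ J := by linarith
    rwa [gammaExp, one_div_pos] at this
  have h2' : ∀ k l, k ∉ J → l ∉ J → k ≠ l →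
      1 / q ≤ invGamma q (fun j => (C j).card) r p k (J ∪ {l}) := by
    intro k l hk hl hkl
    obtain ⟨ha, hb⟩ := h2 k l hk hl hkl
    rw [gammaExp] at ha hb
    rw [one_div_le hq (by rwa [one_div_pos] at ha)]
    exact hb
  have hcard : (Jᶜ).card = (Jᶜ).card - 1 + 1 :=
    (Nat.sub_add_cancel (Finset.card_pos.2 ⟨k₀, Finset.mem_compl.2 hk₀⟩)).symm
  obtain ⟨K, hK⟩ := exists_mixedBound_of_subset hCdisj hr hp h2'
    (exists_mixedBound_singleton hCcover hY hr hp hT) _ Jᶜ hcard (Finset.Subset.refl _) k₀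
    (Finset.mem_compl.2 hk₀) (by rwa [compl_compl])
  rw [compl_compl] at hK
  obtain ⟨K', hK'⟩ := hK.exists_sum_le hCdisj hCcover hp hqs hq h1 hs0 hs
  refine IsMultipleSumming.of_sum_le hs0 (fun j => ?_) hK'
  obtain ⟨l, hl⟩ := hCcover j
  rw [hqs l j hl]
  exact hp l
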